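/- For $n\ge 0$ let $s_\varphi(n)$ be the Zeckendorf sum of digits of $n$: writing $n$ uniquely as $n=\sum_{i\ge 2}\varepsilon_i F_i$, where $F_i$ are the Fibonacci numbers ($F_0=0$, $F_1=1$, $F_i=F_{i-1}+F_{i-2}$), $\varepsilon_i\in\{0,1\}$ and $\varepsilon_i=1\Rightarrow\varepsilon_{i+1}=0$, set $s_\varphi(n)=\sum_{i\ge 2}\varepsilon_i$ (so $s_\varphi(0)=0$). Let $m$ be a bounded complex-valued multiplicative function, that is, $m(1)=1$, $m(ab)=m(a)m(b)$ for all coprime positive integers $a,b$, and $\sup_n|m(n)|<\infty$ (with the convention $m(0)=0$). Then $$\sum_{n<N}(-1)^{s_\varphi(n)}\,m(n)=o(N)\qquad(N\to\infty).$$ In particular, the sequence $\big((-1)^{s_\varphi(n)}\big)_{n\ge0}$, which is morphic (it is the image under a letter-to-letter coding of an infinite fixed point $\sigma^\omega(a)$ of a substitution $\sigma$ over a finite alphabet, where $\sigma(a)$ begins with $a$), is asymptotically orthogonal to the Möbius function $\mu$: $$\sum_{n<N}(-1)^{s_\varphi(n)}\,\mu(n)=o(N)\qquad(N\to\infty),$$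 that is, it satisfies the conclusion of the Sarnak conjecture. -/

import Mathlib

/-- The Zeckendorf sum-of-digits function `s_φ`: the number of digits `1` in the unique expansion
`n = ∑_{i ≥ 2} ε_i F_i` with `ε_i ∈ {0, 1}` and no two consecutive digits equal to `1`.
`Nat.zeckendorf n` is the list of the indices `i` with `ε_i = 1`; it is empty for `n = 0`. -/
def zeckendorfDigitSum (n : ℕ) : ℕ := n.zeckendorf.length

/-- The word `σ^k(a)`, where the substitution `σ` on letters is extended to words by
concatenation. -/
def substIterate {A : Type} (σ : A → List A) (a : A) : ℕ → List A
  | 0 => [a]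
  | k + 1 => (substIterate σ a k).flatMap σ

/-- A sequence is morphic if it is the image under a coding `π` of the infinite fixed point
`σ^ω(a)` of a substitution `σ` over a finite alphabet, where `σ(a)` begins with `a` and the lengths
of the words `σ^k(a)` (each of which is then a prefix of the next) are unbounded. -/
def IsMorphic {B : Type} (x : ℕ → B) : Prop :=
  ∃ (A : Type) (_ : Finite A) (σ : A → List A) (a : A) (π : A → B),
    (∃ w : List A, σ a = a :: w) ∧
    (∀ L : ℕ, ∃ k : ℕ, L ≤ (substIterate σ a k).length) ∧
    ∀ (k i : ℕ) (h : i < (substIterate σ a k).length), π ((substIterate σ a k)[i]) = x i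

open scoped goldenRatio

/-! ### Zeckendorf expansions -/

theorem isZeckendorfRep_iff (l : List ℕ) :
    l.IsZeckendorfRep ↔ l.Pairwise (fun a b => b + 2 ≤ a) ∧ ∀ a ∈ l, 2 ≤ a := by
  have : IsTrans ℕ (fun a b => b + 2 ≤ a) := ⟨fun _ _ _ h h' => by omega⟩
  rw [List.IsZeckendorfRep, List.isChain_iff_pairwise, List.pairwise_append]
  simp

theorem pairwise_zeckendorf (n : ℕ) : n.zeckendorf.Pairwise (fun a b => b + 2 ≤ a) :=
  ((isZeckendorfRep_iff _).1 n.isZeckendorfRep_zeckendorf).1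

theorem two_le_of_mem_zeckendorf {n i : ℕ} (hi : i ∈ n.zeckendorf) : 2 ≤ i :=
  ((isZeckendorfRep_iff _).1 n.isZeckendorfRep_zeckendorf).2 i hi

theorem lt_of_mem_zeckendorf_of_lt_fib {n i J : ℕ} (hn : n < Nat.fib J)
    (hi : i ∈ n.zeckendorf) : i < J := by
  by_contra! h
  have h1 : Nat.fib i ≤ n := by
    conv_rhs => rw [← Nat.sum_zeckendorf_fib n]
    exact List.single_le_sum (by simp) _ (List.mem_map_of_mem hi)
  have := Nat.fib_mono h
  omega

theorem lt_fib_of_forall_mem_zeckendorf {n J : ℕ} (hJ : 0 < J)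
    (h : ∀ i ∈ n.zeckendorf, i < J) : n < Nat.fib J := by
  rw [← Nat.sum_zeckendorf_fib n]
  refine n.isZeckendorfRep_zeckendorf.sum_fib_lt fun a ha => ?_
  have := List.mem_of_mem_head? ha
  rw [List.mem_append, List.mem_singleton] at this
  rcases this with h' | rfl
  · exact h a h'
  · exact hJ

/-- All Zeckendorf digits of `n` below the index `J` vanish. -/
def HighDigits (J n : ℕ) : Prop := ∀ i ∈ n.zeckendorf, J ≤ i

theorem HighDigits.mono {J K n : ℕ} (h : HighDigits K n) (hJ : J ≤ K) : HighDigits J n :=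
  fun i hi => hJ.trans (h i hi)

theorem highDigits_zero (J : ℕ) : HighDigits J 0 := by simp [HighDigits]

theorem highDigits_two (n : ℕ) : HighDigits 2 n := fun _ => two_le_of_mem_zeckendorf

theorem zeckendorf_fib {i : ℕ} (hi : 2 ≤ i) : (Nat.fib i).zeckendorf = [i] := by
  have := Nat.zeckendorf_sum_fib (l := [i]) ((isZeckendorfRep_iff _).2 (by simpa using hi))
  simpa using this

/-- Digits of a small number and of a number with only high digits do not interact. -/
theorem zeckendorf_add {a b J : ℕ} (ha : a < Nat.fib J) (hb : HighDigits (J + 1) b) :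
    (a + b).zeckendorf = b.zeckendorf ++ a.zeckendorf := by
  have hrep : (b.zeckendorf ++ a.zeckendorf).IsZeckendorfRep := by
    rw [isZeckendorfRep_iff, List.pairwise_append]
    refine ⟨⟨pairwise_zeckendorf b, pairwise_zeckendorf a, fun x hx y hy => ?_⟩, fun x hx => ?_⟩
    · have := hb x hx
      have := lt_of_mem_zeckendorf_of_lt_fib ha hy
      omega
    · rcases List.mem_append.1 hx with h | h <;> exact two_le_of_mem_zeckendorf h
  have := Nat.zeckendorf_sum_fib hrep
  rwa [List.map_append, List.sum_append, Nat.sum_zeckendorf_fib, Nat.sum_zeckendorf_fib,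
    add_comm] at this

theorem zeckendorfDigitSum_add {a b J : ℕ} (ha : a < Nat.fib J) (hb : HighDigits (J + 1) b) :
    zeckendorfDigitSum (a + b) = zeckendorfDigitSum a + zeckendorfDigitSum b := by
  simp [zeckendorfDigitSum, zeckendorf_add ha hb, add_comm]

theorem zeckendorfDigitSum_zero : zeckendorfDigitSum 0 = 0 := by simp [zeckendorfDigitSum]

theorem zeckendorfDigitSum_fib {i : ℕ} (hi : 2 ≤ i) : zeckendorfDigitSum (Nat.fib i) = 1 := by
  simp [zeckendorfDigitSum, zeckendorf_fib hi]

theorem highDigits_fib {i : ℕ} (hi : 2 ≤ i) : HighDigits i (Nat.fib i) := by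
  simp [HighDigits, zeckendorf_fib hi]

theorem zeckendorfDigitSum_add_fib {a J : ℕ} (ha : a < Nat.fib J) (hJ : 1 ≤ J) :
    zeckendorfDigitSum (a + Nat.fib (J + 1)) = zeckendorfDigitSum a + 1 := by
  rw [zeckendorfDigitSum_add ha (highDigits_fib (by omega)), zeckendorfDigitSum_fib (by omega)]

/-- Splitting off the lowest Zeckendorf digit. -/
theorem exists_lowest_digit {n : ℕ} (hn : n ≠ 0) :
    ∃ B l : ℕ, 2 ≤ l ∧ n = B + Nat.fib l ∧ HighDigits (l + 2) B ∧
      n.zeckendorf = B.zeckendorf ++ [l] := by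
  rcases List.eq_nil_or_concat n.zeckendorf with h | ⟨L, l, h⟩
  · exact absurd (by rw [← Nat.sum_zeckendorf_fib n, h]; rfl) hn
  · rw [List.concat_eq_append] at h
    have hrep := (isZeckendorfRep_iff _).1 n.isZeckendorfRep_zeckendorf
    rw [h, List.pairwise_append] at hrep
    obtain ⟨⟨h1, -, h3⟩, h4⟩ := hrep
    have hL : ((L.map Nat.fib).sum).zeckendorf = L :=
      Nat.zeckendorf_sum_fib ((isZeckendorfRep_iff _).2
        ⟨h1, fun a ha => h4 a (List.mem_append_left _ ha)⟩)
    refine ⟨(L.map Nat.fib).sum, l, h4 l (by simp), ?_, ?_, ?_⟩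
    · conv_lhs => rw [← Nat.sum_zeckendorf_fib n, h]
      simp
    · intro i hi
      rw [hL] at hi
      exact h3 i hi l (by simp)
    · rw [hL, h]

/-- Cutting the Zeckendorf expansion at the index `J`. -/
theorem exists_high_part {J : ℕ} (hJ : 0 < J) (n : ℕ) :
    ∃ b, HighDigits J b ∧ b ≤ n ∧ n < b + Nat.fib J := by
  induction n using Nat.strong_induction_on with
  | _ n ih =>
    rcases lt_or_ge n (Nat.fib J) with h | h
    · exact ⟨0, highDigits_zero J, n.zero_le, by simpa using h⟩
    · have hn : 0 < n := (Nat.fib_pos.2 hJ).trans_le h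
      set i := n.greatestFib with hi
      have hJi : J ≤ i := Nat.le_greatestFib.2 h
      have hfi : Nat.fib i ≤ n := n.fib_greatestFib_le
      have hi2 : 2 ≤ i := Nat.le_greatestFib.2 (by rw [Nat.fib_two]; exact hn)
      have hlt : n < Nat.fib (i + 1) := n.lt_fib_greatestFib_add_one
      obtain ⟨k, hk⟩ : ∃ k, i = k + 1 := ⟨i - 1, by omega⟩
      have hfib : Nat.fib (i + 1) = Nat.fib k + Nat.fib i := by rw [hk]; exact Nat.fib_add_two
      obtain ⟨b, hb, hbn, hnb⟩ := ih (n - Nat.fib i)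
        (Nat.sub_lt hn (Nat.fib_pos.2 (by omega)))
      refine ⟨b + Nat.fib i, fun j hj => ?_, by omega, by omega⟩
      rw [zeckendorf_add (J := k) (by omega) (by rw [← hk]; exact highDigits_fib hi2),
        zeckendorf_fib hi2, List.mem_append, List.mem_singleton] at hj
      rcases hj with rfl | hj
      · exact hJi
      · exact hb j hj

/-- `F_{l+2} - y = F_{l+1} + (F_l - y)` has one digit more than `F_l - y`. -/
theorem zeckendorfDigitSum_fib_add_two_sub {l y : ℕ} (hl : 1 ≤ l) (hy : 0 < y)
    (hyl : y < Nat.fib l) :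
    zeckendorfDigitSum (Nat.fib (l + 2) - y) = zeckendorfDigitSum (Nat.fib l - y) + 1 := by
  rw [← zeckendorfDigitSum_add_fib (J := l) (by omega) hl, Nat.fib_add_two]
  congr 1
  omega

/-! ### The conjugate of a Zeckendorf expansion -/

/-- The conjugate `∑ ψ ^ i` of the Zeckendorf expansion `∑ F_i` of `n`. -/
noncomputable def zeckConj (n : ℕ) : ℝ := (n.zeckendorf.map (fun i => ψ ^ i)).sum

theorem zeckConj_zero : zeckConj 0 = 0 := by simp [zeckConj]

theorem zeckConj_fib {i : ℕ} (hi : 2 ≤ i) : zeckConj (Nat.fib i) = ψ ^ i := by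
  simp [zeckConj, zeckendorf_fib hi]

theorem abs_goldenConj : |ψ| = -ψ := abs_of_neg Real.goldenConj_neg

theorem goldenConj_bounds : -1 < ψ ∧ ψ < 0 ∧ ψ ^ 2 = ψ + 1 :=
  ⟨Real.neg_one_lt_goldenConj, Real.goldenConj_neg, Real.goldenConj_sq⟩

/-- The index of the lowest digit can be read off from the conjugate. -/
theorem zeckConj_of_lowest_digit (n : ℕ) :
    (∀ J, HighDigits J n → ∃ e : ℝ, zeckConj n = ψ ^ J * e ∧ -1 < e ∧ e < 1 - ψ) ∧
    ∀ B l, n.zeckendorf = B.zeckendorf ++ [l] → HighDigits (l + 2) B →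
      ∃ u : ℝ, zeckConj n = ψ ^ l * u ∧ -ψ < u ∧ u < 1 - ψ := by
  obtain ⟨hψ1, hψ0, hψ⟩ := goldenConj_bounds
  induction n using Nat.strong_induction_on with
  | _ n ih =>
    have key : ∀ B l, n.zeckendorf = B.zeckendorf ++ [l] → HighDigits (l + 2) B →
        ∃ u : ℝ, zeckConj n = ψ ^ l * u ∧ -ψ < u ∧ u < 1 - ψ := by
      intro B l hBl hB
      have hlt : B < n := by
        have h1 : n = B + Nat.fib l := by
          conv_lhs => rw [← Nat.sum_zeckendorf_fib n, hBl]
          simp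
        have h2 : 2 ≤ l := two_le_of_mem_zeckendorf (n := n) (by simp [hBl])
        have := Nat.fib_pos.2 (by omega : 0 < l)
        omega
      obtain ⟨e, he, he1, he2⟩ := (ih B hlt).1 _ hB
      refine ⟨1 + ψ ^ 2 * e, ?_, by nlinarith, by nlinarith⟩
      rw [zeckConj, hBl, List.map_append, List.sum_append]
      change zeckConj B + _ = _
      rw [he, List.map_singleton, List.sum_singleton]
      ring
    refine ⟨fun J hJ => ?_, key⟩
    rcases eq_or_ne n 0 with rfl | hn
    · exact ⟨0, by simp [zeckConj_zero], by norm_num, by linarith⟩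
    obtain ⟨B, l, -, -, hB, hBl⟩ := exists_lowest_digit hn
    obtain ⟨u, hu, hu1, hu2⟩ := key B l hBl hB
    have hJl : J ≤ l := hJ l (by simp [hBl])
    obtain ⟨k, rfl⟩ := Nat.exists_eq_add_of_le hJl
    refine ⟨ψ ^ k * u, by rw [hu]; ring, ?_⟩
    rcases k with _ | k
    · simp only [pow_zero, one_mul]
      constructor <;> linarith
    · have h1 : |ψ ^ (k + 1)| ≤ -ψ := by
        rw [abs_pow, abs_goldenConj]
        exact pow_le_of_le_one (by linarith) (by linarith) (by omega)
      have h2 : |ψ ^ (k + 1) * u| < 1 := by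
        rw [abs_mul, abs_of_pos (by linarith : 0 < u)]
        nlinarith
      have := abs_lt.1 h2
      constructor <;> linarith

theorem abs_zeckConj_lt {J n : ℕ} (h : HighDigits J n) : |zeckConj n| < (-ψ) ^ J * (1 - ψ) := by
  obtain ⟨hψ1, hψ0, hψ⟩ := goldenConj_bounds
  obtain ⟨e, he, he1, he2⟩ := (zeckConj_of_lowest_digit n).1 J h
  rw [he, abs_mul, abs_pow, abs_goldenConj]
  have : 0 < (-ψ) ^ J := pow_pos (by linarith) _
  gcongr
  exact abs_lt.2 ⟨by linarith, he2⟩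

theorem lt_abs_zeckConj {n B l : ℕ} (h : n.zeckendorf = B.zeckendorf ++ [l])
    (hB : HighDigits (l + 2) B) : (-ψ) ^ (l + 1) < |zeckConj n| := by
  obtain ⟨hψ1, hψ0, hψ⟩ := goldenConj_bounds
  obtain ⟨e, he, he1, he2⟩ := (zeckConj_of_lowest_digit n).2 B l h hB
  rw [he, abs_mul, abs_pow, abs_goldenConj, pow_succ, abs_of_pos (by linarith : 0 < e)]
  have : 0 < (-ψ) ^ l := pow_pos (by linarith) _
  gcongr

theorem exists_int_zeckConj (n : ℕ) : ∃ k : ℤ, zeckConj n = k + n * ψ := by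
  have key : ∀ l : List ℕ, (∀ i ∈ l, 2 ≤ i) → ∃ k : ℤ, (l.map (fun i => ψ ^ i)).sum =
      k + ((l.map Nat.fib).sum : ℕ) * ψ := by
    intro l hl
    induction l with
    | nil => exact ⟨0, by simp⟩
    | cons i l ih =>
      obtain ⟨k, hk⟩ := ih fun j hj => hl j (List.mem_cons_of_mem _ hj)
      obtain ⟨j, rfl⟩ : ∃ j, i = j + 1 := ⟨i - 1, by have := hl i (by simp); omega⟩
      refine ⟨k + Nat.fib j, ?_⟩
      rw [List.map_cons, List.sum_cons, hk, List.map_cons, List.sum_cons,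
        ← Real.goldenConj_mul_fib_succ_add_fib]
      push_cast
      ring
  obtain ⟨k, hk⟩ := key n.zeckendorf fun i => two_le_of_mem_zeckendorf
  exact ⟨k, by rw [Nat.sum_zeckendorf_fib] at hk; exact hk⟩

/-- The conjugate is the representative of `n * ψ` modulo `1` in an interval of length `1`. -/
theorem zeckConj_eq_of_mem {n : ℕ} {x : ℝ} (hx : ∃ k : ℤ, x = k + n * ψ)
    (h1 : -(ψ ^ 2) ≤ x) (h2 : x ≤ -ψ) : zeckConj n = x := by
  obtain ⟨hψ1, hψ0, hψ⟩ := goldenConj_bounds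
  obtain ⟨k, hk⟩ := hx
  obtain ⟨j, hj⟩ := exists_int_zeckConj n
  obtain ⟨e, he, he1, he2⟩ := (zeckConj_of_lowest_digit n).1 2 (highDigits_two n)
  have hjk : |((j - k : ℤ) : ℝ)| < 1 := by
    push_cast
    have : (j : ℝ) - k = ψ ^ 2 * e - x := by rw [← he, hj, hk]; ring
    rw [this, hψ, abs_lt]
    constructor <;> nlinarith
  have : j - k = 0 := by
    rw [← Int.abs_lt_one_iff]
    exact_mod_cast hjk
  rw [hj, hk, show j = k by omega]

theorem zeckConj_mul {p n : ℕ} (h : p * |zeckConj n| ≤ ψ ^ 2) :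
    zeckConj (p * n) = p * zeckConj n := by
  obtain ⟨hψ1, hψ0, hψ⟩ := goldenConj_bounds
  obtain ⟨k, hk⟩ := exists_int_zeckConj n
  have h' : |p * zeckConj n| ≤ ψ ^ 2 := by rwa [abs_mul, Nat.abs_cast]
  have := abs_le.1 h'
  refine zeckConj_eq_of_mem ⟨p * k, ?_⟩ this.1 (this.2.trans (by nlinarith))
  rw [hk]
  push_cast
  ring

/-! ### Shifting digits -/

/-- The number whose Zeckendorf digits are those of `n`, moved up by one place. -/
def zeckShift (n : ℕ) : ℕ := ((n.zeckendorf.map (· + 1)).map Nat.fib).sum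

theorem zeckendorf_zeckShift (n : ℕ) :
    (zeckShift n).zeckendorf = n.zeckendorf.map (· + 1) := by
  refine Nat.zeckendorf_sum_fib ((isZeckendorfRep_iff _).2 ⟨?_, ?_⟩)
  · rw [List.pairwise_map]
    exact (pairwise_zeckendorf n).imp fun h => by omega
  · intro a ha
    obtain ⟨b, hb, rfl⟩ := List.mem_map.1 ha
    have := two_le_of_mem_zeckendorf hb
    omega

theorem zeckendorfDigitSum_zeckShift (n : ℕ) :
    zeckendorfDigitSum (zeckShift n) = zeckendorfDigitSum n := by
  simp [zeckendorfDigitSum, zeckendorf_zeckShift]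

theorem zeckConj_zeckShift (n : ℕ) : zeckConj (zeckShift n) = ψ * zeckConj n := by
  rw [zeckConj, zeckendorf_zeckShift, zeckConj, ← List.sum_map_mul_left, List.map_map]
  congr 1
  exact List.map_congr_left fun i _ => by simp [pow_succ']

theorem cast_zeckShift (n : ℕ) : (zeckShift n : ℝ) = φ * n + zeckConj n := by
  have key : ∀ l : List ℕ, (((l.map (· + 1)).map Nat.fib).sum : ℝ) =
      φ * ((l.map Nat.fib).sum : ℕ) + (l.map (fun i => ψ ^ i)).sum := by
    intro l
    induction l with
    | nil => simp
    | cons i l ih =>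
      simp only [List.map_cons, List.sum_cons, Nat.cast_add] at ih ⊢
      rw [ih, ← Real.fib_succ_sub_goldenRatio_mul_fib]
      ring
  have := key n.zeckendorf
  rwa [Nat.sum_zeckendorf_fib] at this

theorem HighDigits.zeckShift {J n : ℕ} (h : HighDigits J n) :
    HighDigits (J + 1) (zeckShift n) := by
  intro i hi
  rw [zeckendorf_zeckShift] at hi
  obtain ⟨j, hj, rfl⟩ := List.mem_map.1 hi
  have := h j hj
  omega

theorem zeckShift_lt_fib {J n : ℕ} (h : n < Nat.fib J) : zeckShift n < Nat.fib (J + 1) := by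
  refine lt_fib_of_forall_mem_zeckendorf J.succ_pos fun i hi => ?_
  rw [zeckendorf_zeckShift] at hi
  obtain ⟨j, hj, rfl⟩ := List.mem_map.1 hi
  have := lt_of_mem_zeckendorf_of_lt_fib h hj
  omega

theorem HighDigits.iterate_zeckShift {J n : ℕ} (h : HighDigits J n) (k : ℕ) :
    HighDigits (J + k) (_root_.zeckShift^[k] n) := by
  induction k with
  | zero => exact h
  | succ k ih => rw [Function.iterate_succ_apply']; exact ih.zeckShift

theorem iterate_zeckShift_lt_fib {J n : ℕ} (h : n < Nat.fib J) (k : ℕ) :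
    zeckShift^[k] n < Nat.fib (J + k) := by
  induction k with
  | zero => exact h
  | succ k ih => rw [Function.iterate_succ_apply']; exact zeckShift_lt_fib ih

theorem zeckConj_iterate_zeckShift (n k : ℕ) :
    zeckConj (zeckShift^[k] n) = ψ ^ k * zeckConj n := by
  induction k with
  | zero => simp
  | succ k ih => rw [Function.iterate_succ_apply', zeckConj_zeckShift, ih]; ring

theorem zeckendorfDigitSum_iterate_zeckShift (n k : ℕ) :
    zeckendorfDigitSum (zeckShift^[k] n) = zeckendorfDigitSum n := by
  induction k with
  | zero => rfl
  | succ k ih => rw [Function.iterate_succ_apply', zeckendorfDigitSum_zeckShift, ih]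

theorem zeckendorf_iterate_zeckShift (n k : ℕ) :
    (zeckShift^[k] n).zeckendorf = n.zeckendorf.map (· + k) := by
  induction k with
  | zero => simp
  | succ k ih =>
    rw [Function.iterate_succ_apply', zeckendorf_zeckShift, ih, List.map_map]
    rfl

theorem mul_iterate_zeckShift {p n : ℕ} (h : zeckConj (p * n) = p * zeckConj n) (k : ℕ) :
    p * zeckShift^[k] n = zeckShift^[k] (p * n) := by
  induction k with
  | zero => rfl
  | succ k ih =>
    rw [Function.iterate_succ_apply', Function.iterate_succ_apply', ← ih]
    have h1 : zeckConj (p * zeckShift^[k] n) = p * zeckConj (zeckShift^[k] n) := by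
      rw [ih, zeckConj_iterate_zeckShift, zeckConj_iterate_zeckShift, h]
      ring
    have : ((p * zeckShift (zeckShift^[k] n) : ℕ) : ℝ) = zeckShift (p * zeckShift^[k] n) := by
      rw [Nat.cast_mul, cast_zeckShift, cast_zeckShift, h1]
      push_cast
      ring
    exact_mod_cast this

/-! ### Multiples of numbers with high digits -/

theorem fib_le_of_highDigits {J n : ℕ} (h : HighDigits J n) (hn : n ≠ 0) : Nat.fib J ≤ n := by
  obtain ⟨B, l, -, hnB, -, hz⟩ := exists_lowest_digit hn
  have := Nat.fib_mono (h l (by simp [hz]))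
  omega

theorem lowest_digit_eq {n B l k : ℕ} (hz : n.zeckendorf = B.zeckendorf ++ [l])
    (hB : HighDigits (l + 2) B) (h1 : (-ψ) ^ (2 * k + 3) < zeckConj n)
    (h2 : zeckConj n < (-ψ) ^ (2 * k + 1)) : l = 2 * k + 2 := by
  obtain ⟨hψ1, hψ0, hψ⟩ := goldenConj_bounds
  have ht0 : 0 < -ψ := by linarith
  have ht1 : -ψ < 1 := by linarith
  obtain ⟨u, hu, hu1, hu2⟩ := (zeckConj_of_lowest_digit n).2 B l hz hB
  have hpos : 0 < zeckConj n := (pow_pos ht0 _).trans h1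
  have heven : Even l := by
    by_contra hodd
    have := (Nat.not_even_iff_odd.1 hodd).pow_neg hψ0
    rw [hu] at hpos
    nlinarith
  rw [hu, ← heven.neg_pow] at h1 h2
  have hl : 0 < (-ψ) ^ l := pow_pos ht0 _
  have h3 : (-ψ) ^ (l + 1) < (-ψ) ^ (2 * k + 1) := by
    refine lt_trans ?_ h2
    rw [pow_succ]
    gcongr
  have h4 : (-ψ) ^ (2 * k + 4) < (-ψ) ^ l := by
    have h5 : u * -ψ < 1 := by nlinarith
    calc (-ψ) ^ (2 * k + 4) = (-ψ) ^ (2 * k + 3) * -ψ := pow_succ _ _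
      _ < (-ψ) ^ l * u * -ψ := by gcongr
      _ = (-ψ) ^ l * (u * -ψ) := by ring
      _ < (-ψ) ^ l * 1 := by gcongr
      _ = _ := mul_one _
  rw [pow_lt_pow_iff_right_of_lt_one₀ ht0 ht1] at h3 h4
  obtain ⟨j, rfl⟩ := heven
  omega

theorem HighDigits.mul {p c J b : ℕ} (hp : p * (-ψ) ^ c ≤ ψ ^ 2) (hJ : 1 ≤ J)
    (hb : HighDigits (J + c) b) : HighDigits J (p * b) := by
  obtain ⟨hψ1, hψ0, hψ⟩ := goldenConj_bounds
  have ht0 : 0 < -ψ := by linarith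
  have ht1 : -ψ < 1 := by linarith
  have hJ' : 0 < (-ψ) ^ J := pow_pos ht0 _
  have h1 : p * |zeckConj b| ≤ (-ψ) ^ (J + 1) := by
    calc (p : ℝ) * |zeckConj b| ≤ p * ((-ψ) ^ (J + c) * (1 - ψ)) := by
          gcongr; exact (abs_zeckConj_lt hb).le
      _ = (p * (-ψ) ^ c) * ((-ψ) ^ J * (1 - ψ)) := by ring
      _ ≤ ψ ^ 2 * ((-ψ) ^ J * (1 - ψ)) := by
          gcongr
          exact mul_nonneg hJ'.le (by linarith)
      _ = (-ψ) ^ J * (ψ ^ 2 * (1 - ψ)) := by ring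
      _ = (-ψ) ^ J * (-ψ) := by congr 1; rw [hψ]; linarith [hψ]
      _ = _ := (pow_succ _ _).symm
  have h2 : (-ψ) ^ (J + 1) ≤ ψ ^ 2 := by
    rw [← neg_sq ψ]
    exact pow_le_pow_of_le_one ht0.le ht1.le (by omega)
  have h3 := zeckConj_mul (h1.trans h2)
  intro i hi
  have hne : p * b ≠ 0 := fun h => by simp [h] at hi
  obtain ⟨B, l, -, -, hB, hz⟩ := exists_lowest_digit hne
  have h4 := lt_abs_zeckConj hz hB
  rw [h3, abs_mul, Nat.abs_cast] at h4
  have h5 := h4.trans_le h1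
  rw [pow_lt_pow_iff_right_of_lt_one₀ ht0 ht1] at h5
  rw [hz, List.mem_append, List.mem_singleton] at hi
  rcases hi with hi | rfl
  · have := hB i hi
    omega
  · omega

theorem mul_lt_fib {p c M a : ℕ} (hp : p ≤ Nat.fib (c + 1)) (hM : 1 ≤ M) (ha : a < Nat.fib M) :
    p * a < Nat.fib (M + c) := by
  obtain ⟨m, rfl⟩ : ∃ m, M = m + 1 := ⟨M - 1, by omega⟩
  have h1 : Nat.fib (m + 1 + c) = Nat.fib m * Nat.fib c + Nat.fib (m + 1) * Nat.fib (c + 1) := by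
    rw [← Nat.fib_add]
    congr 1
    omega
  have h2 : p * a ≤ Nat.fib (c + 1) * a := Nat.mul_le_mul_right _ hp
  have h3 : Nat.fib (c + 1) * a < Nat.fib (c + 1) * Nat.fib (m + 1) :=
    Nat.mul_lt_mul_of_pos_left ha (Nat.fib_pos.2 c.succ_pos)
  rw [h1, mul_comm (Nat.fib (m + 1))]
  omega

/-- The function `n ↦ s_φ(p n)` is additive on expansions separated by enough zeros. -/
theorem zeckendorfDigitSum_mul_add {p c M a b : ℕ} (hp : p * (-ψ) ^ c ≤ ψ ^ 2)
    (hp' : p ≤ Nat.fib (c + 1)) (hM : 1 ≤ M) (ha : a < Nat.fib M)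
    (hb : HighDigits (M + 2 * c + 1) b) :
    zeckendorfDigitSum (p * (a + b)) =
      zeckendorfDigitSum (p * a) + zeckendorfDigitSum (p * b) := by
  rw [mul_add]
  refine zeckendorfDigitSum_add (mul_lt_fib hp' hM ha) (HighDigits.mul hp (by omega) ?_)
  convert hb using 1
  omega

/-! ### A number whose multiples have digit sums of different parity -/

theorem exists_zeckConj_mem {α β : ℝ} (hα : 0 ≤ α) (hαβ : α < β) (hβ : β ≤ ψ ^ 2) :
    ∃ x : ℕ, α < zeckConj x ∧ zeckConj x < β := by
  obtain ⟨hψ1, hψ0, hψ⟩ := goldenConj_bounds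
  have hsq : ψ ^ 2 < 1 := by nlinarith
  have hsq0 : 0 < ψ ^ 2 := by nlinarith
  obtain ⟨c, hc⟩ := exists_pow_lt_of_lt_one (sub_pos.2 hαβ) hsq
  have hpos : 0 < (ψ ^ 2) ^ (c + 1) := pow_pos hsq0 _
  have hc' : (ψ ^ 2) ^ (c + 1) < β - α :=
    (pow_le_pow_of_le_one hsq0.le hsq.le (by omega)).trans_lt hc
  have hfib : zeckConj (Nat.fib (2 * (c + 1))) = (ψ ^ 2) ^ (c + 1) := by
    rw [zeckConj_fib (by omega), pow_mul]
  set d := (ψ ^ 2) ^ (c + 1) with hd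
  have h1 : α < (⌊α / d⌋₊ + 1 : ℕ) * d := by
    rw [← div_lt_iff₀ hpos]
    push_cast
    exact Nat.lt_floor_add_one _
  have h2 : (⌊α / d⌋₊ + 1 : ℕ) * d < β := by
    have := Nat.floor_le (div_nonneg hα hpos.le)
    rw [le_div_iff₀ hpos] at this
    push_cast
    linarith
  have h3 : zeckConj ((⌊α / d⌋₊ + 1) * Nat.fib (2 * (c + 1))) = (⌊α / d⌋₊ + 1 : ℕ) * d := by
    rw [zeckConj_mul, hfib]
    rw [hfib, abs_of_pos hpos]
    exact h2.le.trans hβ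
  exact ⟨_, by rwa [h3], by rwa [h3]⟩

theorem zeckendorfDigitSum_sub {n B l y : ℕ} (hn : n = B + Nat.fib l) (hl : 2 ≤ l)
    (hB : HighDigits (l + 2) B) (hy : 0 < y) (hyl : y < Nat.fib l) :
    zeckendorfDigitSum (n - y) + 1 =
      zeckendorfDigitSum n + zeckendorfDigitSum (Nat.fib l - y) := by
  have h1 : n - y = (Nat.fib l - y) + B := by omega
  have h2 : n = Nat.fib l + B := by omega
  have h3 : Nat.fib l < Nat.fib (l + 1) := Nat.fib_lt_fib_succ hl
  rw [h1, zeckendorfDigitSum_add (J := l) (by omega) (hB.mono (by omega)), h2,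
    zeckendorfDigitSum_add (J := l + 1) h3 hB, zeckendorfDigitSum_fib hl]
  omega

theorem zeckendorfDigitSum_mul_shift_sub {p x k l y : ℕ} (hl : (-ψ) ^ (2 * l + 3) < p * zeckConj x)
    (hl' : p * zeckConj x < (-ψ) ^ (2 * l + 1)) (hx : p * |zeckConj x| ≤ ψ ^ 2)
    (hy : 0 < p * y) (hyl : p * y < Nat.fib (2 * l + 2 + k)) :
    zeckendorfDigitSum (p * (zeckShift^[k] x - y)) + 1 = zeckendorfDigitSum (p * zeckShift^[k] x) +
      zeckendorfDigitSum (Nat.fib (2 * l + 2 + k) - p * y) := by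
  have hpx := zeckConj_mul hx
  have hne : p * x ≠ 0 := by
    intro h
    rw [h, zeckConj_zero] at hpx
    rw [← hpx] at hl
    have : 0 < (-ψ) ^ (2 * l + 3) := pow_pos (by linarith [Real.goldenConj_neg]) _
    linarith
  obtain ⟨B, j, hj, -, hB, hz⟩ := exists_lowest_digit hne
  obtain rfl := lowest_digit_eq hz hB (by rwa [hpx]) (by rwa [hpx])
  rw [Nat.mul_sub, mul_iterate_zeckShift hpx]
  refine zeckendorfDigitSum_sub (B := zeckShift^[k] B) ?_ (by omega) ?_ hy hyl
  · conv_lhs => rw [← Nat.sum_zeckendorf_fib (zeckShift^[k] (p * x))]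
    conv_rhs => rw [← Nat.sum_zeckendorf_fib (zeckShift^[k] B)]
    rw [zeckendorf_iterate_zeckShift, hz, zeckendorf_iterate_zeckShift]
    simp
  · exact (hB.iterate_zeckShift k).mono (by omega)

theorem ratio_ne_pow_goldenConj {p q n : ℕ} (hp : 0 < p) (hpq : p < q) :
    (p : ℝ) / q ≠ (ψ ^ 2) ^ n := by
  intro h
  have hq : (0 : ℝ) < q := by exact_mod_cast hp.trans hpq
  rcases n with _ | n
  · rw [pow_zero, div_eq_one_iff_eq hq.ne'] at h
    exact hpq.ne (by exact_mod_cast h)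
  · rw [← pow_mul, show 2 * (n + 1) = (2 * n + 1) + 1 by ring,
      ← Real.goldenConj_mul_fib_succ_add_fib] at h
    have hirr : Irrational (ψ * (Nat.fib (2 * n + 1 + 1) : ℕ) + (Nat.fib (2 * n + 1) : ℕ)) :=
      (Real.goldenConj_irrational.mul_natCast (Nat.fib_pos.2 (by omega)).ne').add_natCast _
    exact hirr ⟨(p : ℚ) / q, by rw [← h]; push_cast; rfl⟩

theorem zeckConj_sub {X y : ℕ} (hy : y ≤ X) (h : |zeckConj X| + |zeckConj y| ≤ ψ ^ 2) :
    zeckConj (X - y) = zeckConj X - zeckConj y := by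
  obtain ⟨hψ1, hψ0, hψ⟩ := goldenConj_bounds
  obtain ⟨i, hi⟩ := exists_int_zeckConj X
  obtain ⟨j, hj⟩ := exists_int_zeckConj y
  have h1 := abs_le.1 ((abs_sub (zeckConj X) (zeckConj y)).trans h)
  refine zeckConj_eq_of_mem ⟨i - j, ?_⟩ h1.1 (h1.2.trans (by nlinarith))
  rw [hi, hj, Nat.cast_sub hy]
  push_cast
  ring

theorem exists_odd_zeckendorfDigitSum {p q : ℕ} (hp : 0 < p) (hpq : p < q) :
    ∃ w : ℕ, zeckConj (p * w) = p * zeckConj w ∧ zeckConj (q * w) = q * zeckConj w ∧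
      Odd (zeckendorfDigitSum (p * w) + zeckendorfDigitSum (q * w)) := by
  obtain ⟨hψ1, hψ0, hψ⟩ := goldenConj_bounds
  have ht0 : 0 < -ψ := by linarith
  have ht1 : -ψ < 1 := by linarith
  have hsq : ψ ^ 2 < 1 := by nlinarith
  have hsq0 : 0 < ψ ^ 2 := by nlinarith
  have hpR : (0 : ℝ) < p := by exact_mod_cast hp
  have hqR : (0 : ℝ) < q := by exact_mod_cast hp.trans hpq
  have hpqR : (p : ℝ) < q := by exact_mod_cast hpq
  obtain ⟨n, hn1, hn2⟩ := exists_nat_pow_near_of_lt_one (div_pos hpR hqR)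
    ((div_le_one hqR).2 hpqR.le) hsq0 hsq
  replace hn2 := lt_of_le_of_ne hn2 (ratio_ne_pow_goldenConj hp hpq)
  have ht3 : (0 : ℝ) < (-ψ) ^ 3 := pow_pos ht0 3
  have hidx : 2 * (n + 1) + 3 = 2 * n + 5 := by ring
  have hidx' : 2 * (n + 1) + 1 = 2 * n + 3 := by ring
  have hup : (-ψ) ^ (2 * n + 5) < p * ((-ψ) ^ 3 / q) := by
    calc (-ψ) ^ (2 * n + 5) = (ψ ^ 2) ^ (n + 1) * (-ψ) ^ 3 := by
          rw [← neg_sq ψ, ← pow_mul, ← pow_add, hidx]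
      _ < p / q * (-ψ) ^ 3 := by gcongr
      _ = _ := by ring
  have hlow : p * ((-ψ) ^ 3 / q) < (-ψ) ^ (2 * n + 3) := by
    calc p * ((-ψ) ^ 3 / q) = p / q * (-ψ) ^ 3 := by ring
      _ < (ψ ^ 2) ^ n * (-ψ) ^ 3 := by gcongr
      _ = _ := by rw [← neg_sq ψ, ← pow_mul, ← pow_add]
  have h32 : (-ψ) ^ 3 < ψ ^ 2 := by
    rw [← neg_sq ψ]; exact pow_lt_pow_right_of_lt_one₀ ht0 ht1 (by omega)
  have h53 : (-ψ) ^ 5 < (-ψ) ^ 3 := pow_lt_pow_right_of_lt_one₀ ht0 ht1 (by omega)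
  have h21 : ψ ^ 2 < (-ψ) ^ 1 := by
    rw [← neg_sq ψ]; exact pow_lt_pow_right_of_lt_one₀ ht0 ht1 (by omega)
  have hq1 : (1 : ℝ) ≤ q := by exact_mod_cast (by omega : 1 ≤ q)
  have hθ : (-ψ) ^ 3 / q ≤ ψ ^ 2 := (div_le_self ht3.le hq1).trans h32.le
  -- a number whose `q`-multiple has lowest digit `2`
  obtain ⟨x, hx1, hx2⟩ := exists_zeckConj_mem (α := (-ψ) ^ 3 / q)
    (β := min (ψ ^ 2 / q) ((-ψ) ^ (2 * n + 3) / p)) (by positivity)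
    (lt_min (by gcongr) ((lt_div_iff₀' hpR).2 hlow))
    ((min_le_left _ _).trans (div_le_self hsq0.le hq1))
  -- a number whose `q`-multiple has lowest digit `4`
  obtain ⟨z, hz1, hz2⟩ := exists_zeckConj_mem (α := max ((-ψ) ^ 5 / q) ((-ψ) ^ (2 * n + 5) / p))
    (β := (-ψ) ^ 3 / q) (le_max_of_le_left (by positivity))
    (max_lt (by gcongr) ((div_lt_iff₀' hpR).2 hup)) hθ
  obtain ⟨hx2, hx3⟩ := lt_min_iff.1 hx2
  obtain ⟨hz3, hz4⟩ := max_lt_iff.1 hz1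
  rw [div_lt_iff₀' hqR] at hx1 hz3
  rw [lt_div_iff₀' hqR] at hx2 hz2
  rw [lt_div_iff₀' hpR] at hx3
  rw [div_lt_iff₀' hpR] at hz4
  have hxpos : 0 < zeckConj x := pos_of_mul_pos_right (ht3.trans hx1) hqR.le
  have hzpos : 0 < zeckConj z := pos_of_mul_pos_right ((pow_pos ht0 5).trans hz3) hqR.le
  have hxz : p * zeckConj z < p * zeckConj x := by
    gcongr
    exact lt_of_mul_lt_mul_left (hz2.trans hx1) hqR.le
  have hpx : p * zeckConj x ≤ q * zeckConj x := by gcongr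
  have hpz : p * zeckConj z ≤ q * zeckConj z := by gcongr
  have hqx' : q * |zeckConj x| ≤ ψ ^ 2 := by rw [abs_of_pos hxpos]; exact hx2.le
  have hqz' : q * |zeckConj z| ≤ ψ ^ 2 := by rw [abs_of_pos hzpos]; linarith
  have hpx' : p * |zeckConj x| ≤ ψ ^ 2 := by rw [abs_of_pos hxpos]; linarith
  have hpz' : p * |zeckConj z| ≤ ψ ^ 2 := by rw [abs_of_pos hzpos]; linarith
  -- the small number to subtract, and the shift
  obtain ⟨c, hc⟩ := exists_pow_lt_of_lt_one (show 0 < ψ ^ 2 / (2 * q) by positivity) ht1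
  set y := Nat.fib (c + 2) with hy
  have hy0 : 0 < y := Nat.fib_pos.2 (by omega)
  set k := max (c + 2) (q * y + 5) with hk
  have hkc : c ≤ k := by omega
  have hyk : q * y < Nat.fib k := by
    have := Nat.le_fib_self (n := k) (by omega)
    omega
  have hpyk : p * y < Nat.fib k := (Nat.mul_le_mul_right y hpq.le).trans_lt hyk
  have hyc : q * |zeckConj y| ≤ ψ ^ 2 / 2 := by
    rw [hy, zeckConj_fib (by omega), abs_pow, abs_goldenConj]
    calc (q : ℝ) * (-ψ) ^ (c + 2) ≤ q * (ψ ^ 2 / (2 * q)) := by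
          gcongr
          exact (pow_le_pow_of_le_one ht0.le ht1.le (by omega)).trans hc.le
      _ = _ := by field_simp
  have hshift : ∀ x : ℕ, 0 < zeckConj x → q * |zeckConj x| ≤ ψ ^ 2 →
      q * |zeckConj (zeckShift^[k] x)| ≤ ψ ^ 2 / 2 ∧
      q * |zeckConj (zeckShift^[k] x - y)| ≤ ψ ^ 2 := by
    intro x hx hx'
    have h1 : |zeckConj x| ≤ 1 := by
      refine le_trans ?_ (hx'.trans hsq.le)
      exact le_mul_of_one_le_left (abs_nonneg _) hq1
    have h2 : q * |zeckConj (zeckShift^[k] x)| ≤ ψ ^ 2 / 2 := by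
      rw [zeckConj_iterate_zeckShift, abs_mul, abs_pow, abs_goldenConj]
      calc (q : ℝ) * ((-ψ) ^ k * |zeckConj x|) ≤ q * (ψ ^ 2 / (2 * q) * 1) := by
            gcongr
            exact (pow_le_pow_of_le_one ht0.le ht1.le hkc).trans hc.le
        _ = _ := by field_simp
    refine ⟨h2, ?_⟩
    have h3 : y ≤ zeckShift^[k] x := by
      have hne : zeckShift^[k] x ≠ 0 := by
        intro h0
        have := zeckConj_iterate_zeckShift x k
        rw [h0, zeckConj_zero] at this
        exact (mul_ne_zero (pow_ne_zero k hψ0.ne) hx.ne') this.symm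
      have := fib_le_of_highDigits ((highDigits_two x).iterate_zeckShift k) hne
      have := Nat.fib_mono (by omega : c + 2 ≤ 2 + k)
      omega
    have h4 : q * (|zeckConj (zeckShift^[k] x)| + |zeckConj y|) ≤ ψ ^ 2 := by linarith
    rw [zeckConj_sub h3 ((le_mul_of_one_le_left (by positivity) hq1).trans h4)]
    refine le_trans ?_ h4
    gcongr
    exact abs_sub _ _
  have hgood : ∀ w : ℕ, q * |zeckConj w| ≤ ψ ^ 2 →
      zeckConj (p * w) = p * zeckConj w ∧ zeckConj (q * w) = q * zeckConj w := fun w hw =>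
    ⟨zeckConj_mul (le_trans (by gcongr) hw), zeckConj_mul hw⟩
  have hpy0 : 0 < p * y := Nat.mul_pos hp hy0
  have hqy0 : 0 < q * y := Nat.mul_pos (hp.trans hpq) hy0
  have hk0 : ∀ i, Nat.fib k ≤ Nat.fib (i + k) := fun i => Nat.fib_mono (by omega)
  have e1 := zeckendorfDigitSum_mul_shift_sub (k := k) (l := n + 1)
    (by rw [hidx]; linarith) (by rw [hidx']; linarith) hpx' hpy0 (hpyk.trans_le (hk0 _))
  have e2 := zeckendorfDigitSum_mul_shift_sub (k := k) (l := n + 1)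
    (by rw [hidx]; linarith) (by rw [hidx']; linarith) hpz' hpy0 (hpyk.trans_le (hk0 _))
  have e3 := zeckendorfDigitSum_mul_shift_sub (k := k) (l := 0) hx1 (hx2.trans h21) hqx' hqy0
    (hyk.trans_le (hk0 _))
  have e4 := zeckendorfDigitSum_mul_shift_sub (k := k) (l := 1) hz3 hz2 hqz' hqy0
    (hyk.trans_le (hk0 _))
  have e5 := zeckendorfDigitSum_fib_add_two_sub (l := 2 + k) (by omega) hqy0
    (hyk.trans_le (hk0 _))
  rw [show 2 * 1 + 2 + k = 2 + k + 2 by omega, e5] at e4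
  simp only [mul_zero, zero_add] at e3
  obtain ⟨hX, hXy⟩ := hshift x hxpos hqx'
  obtain ⟨hZ, hZy⟩ := hshift z hzpos hqz'
  by_contra! hcon
  have f : ∀ w : ℕ, q * |zeckConj w| ≤ ψ ^ 2 →
      (zeckendorfDigitSum (p * w) + zeckendorfDigitSum (q * w)) % 2 = 0 := fun w hw =>
    Nat.even_iff.1 (Nat.not_odd_iff_even.1 (hcon w (hgood w hw).1 (hgood w hw).2))
  have f1 := f _ (hX.trans (by linarith))
  have f2 := f _ hXy
  have f3 := f _ (hZ.trans (by linarith))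
  have f4 := f _ hZy
  omega

/-- Inserting a suitable block into a long run of zero digits changes the parity of
`s_φ(p n) + s_φ(q n)`. -/
theorem exists_parity_flip {p q : ℕ} (hp : 0 < p) (hpq : p < q) :
    ∃ K : ℕ, ∀ M, 1 ≤ M → ∀ b, HighDigits (M + K) b → ∃ w, Nat.fib M ≤ w ∧
      w + Nat.fib M ≤ Nat.fib (M + K) ∧ ∀ a < Nat.fib M,
        Odd (zeckendorfDigitSum (p * (a + w + b)) + zeckendorfDigitSum (q * (a + w + b)) +
          (zeckendorfDigitSum (p * (a + b)) + zeckendorfDigitSum (q * (a + b)))) := by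
  obtain ⟨hψ1, hψ0, hψ⟩ := goldenConj_bounds
  have ht0 : 0 < -ψ := by linarith
  have ht1 : -ψ < 1 := by linarith
  have hqR : (0 : ℝ) < q := by exact_mod_cast hp.trans hpq
  obtain ⟨w, hwp, hwq, hw⟩ := exists_odd_zeckendorfDigitSum hp hpq
  obtain ⟨d, hd⟩ := exists_pow_lt_of_lt_one (div_pos (by linarith : 0 < ψ ^ 2) hqR) ht1
  set c := max d (q + 5) with hc
  have hcq : q * (-ψ) ^ c ≤ ψ ^ 2 := by
    rw [← le_div_iff₀' hqR]
    exact (pow_le_pow_of_le_one ht0.le ht1.le (by omega)).trans hd.le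
  have hcp : p * (-ψ) ^ c ≤ ψ ^ 2 := by
    refine le_trans ?_ hcq
    gcongr
  have hcq' : q ≤ Nat.fib (c + 1) := by
    have := Nat.le_fib_self (n := c + 1) (by omega)
    omega
  set k := w + 5 with hk
  have hwk : w < Nat.fib k := by
    have := Nat.le_fib_self (n := k) (by omega)
    omega
  refine ⟨k + 4 * c + 4, fun M hM b hb => ?_⟩
  set W := zeckShift^[M + 2 * c + 1] w with hW
  have hWhigh : HighDigits (M + 2 * c + 1) W :=
    ((highDigits_two w).iterate_zeckShift _).mono (by omega)
  have hWlt : W < Nat.fib (k + (M + 2 * c + 1)) := iterate_zeckShift_lt_fib hwk _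
  have hWsum : W + Nat.fib M ≤ Nat.fib (M + k + 2 * c + 3) := by
    rw [Nat.fib_add_two]
    have h1 := Nat.fib_mono (by omega : M ≤ M + k + 2 * c + 1)
    have h2 := Nat.fib_mono (by omega : k + (M + 2 * c + 1) ≤ M + k + 2 * c + 1 + 1)
    omega
  have hdig : ∀ r : ℕ, r * (-ψ) ^ c ≤ ψ ^ 2 → r ≤ Nat.fib (c + 1) →
      zeckConj (r * w) = r * zeckConj w → ∀ a < Nat.fib M,
      zeckendorfDigitSum (r * (a + W + b)) =
        zeckendorfDigitSum (r * (a + b)) + zeckendorfDigitSum (r * w) := by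
    intro r hr hr' hrw a ha
    rw [zeckendorfDigitSum_mul_add (M := M + k + 2 * c + 3) hr hr' (by omega) (by omega)
        (hb.mono (by omega)),
      zeckendorfDigitSum_mul_add hr hr' hM ha hWhigh, zeckendorfDigitSum_mul_add hr hr' hM ha
        (hb.mono (by omega)), hW, mul_iterate_zeckShift hrw, zeckendorfDigitSum_iterate_zeckShift]
    ring
  have hWne : W ≠ 0 := by
    intro h0
    have h1 : zeckendorfDigitSum (p * W) = zeckendorfDigitSum (p * w) := by
      rw [hW, mul_iterate_zeckShift hwp, zeckendorfDigitSum_iterate_zeckShift]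
    have h2 : zeckendorfDigitSum (q * W) = zeckendorfDigitSum (q * w) := by
      rw [hW, mul_iterate_zeckShift hwq, zeckendorfDigitSum_iterate_zeckShift]
    rw [h0, mul_zero, zeckendorfDigitSum_zero] at h1 h2
    rw [← h1, ← h2] at hw
    simp at hw
  refine ⟨W, ?_, ?_, fun a ha => ?_⟩
  · exact (Nat.fib_mono (by omega)).trans (fib_le_of_highDigits hWhigh hWne)
  · exact hWsum.trans (Nat.fib_mono (by omega))
  · rw [hdig p hcp (hpq.le.trans hcq') hwp a ha,
      hdig q hcq hcq' hwq a ha]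
    rw [Nat.odd_iff] at hw ⊢
    omega

/-! ### Averages over intervals -/

/-- If arbitrarily long intervals contain two disjoint subintervals of proportional length whose
contributions cancel, then the averages of `h` over intervals tend to zero uniformly. -/
theorem interval_sum_le_of_cancelling {h : ℕ → ℝ} (hh : ∀ n, |h n| ≤ 1) {c : ℝ} (hc : 0 < c)
    (hcancel : ∀ L₀ : ℕ, ∃ L, L₀ ≤ L ∧ 0 < L ∧ ∀ u, ∃ i j r len : ℕ,
      i + len + j + len + r = L ∧ c * L ≤ len ∧
      ∑ a ∈ Finset.range len, (h (u + i + a) + h (u + i + len + j + a)) = 0) :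
    ∀ ε > 0, ∃ C : ℝ, ∀ u N : ℕ, |∑ a ∈ Finset.range N, h (u + a)| ≤ ε * N + C := by
  have hbound : ∀ u N : ℕ, |∑ a ∈ Finset.range N, h (u + a)| ≤ N := fun u N =>
    (Finset.abs_sum_le_sum_abs _ _).trans ((Finset.sum_le_sum fun a _ => hh _).trans (by simp))
  set y : ℕ → ℝ := fun N => ⨆ u : ℕ, |∑ a ∈ Finset.range N, h (u + a)| with hy
  have hle : ∀ u N : ℕ, |∑ a ∈ Finset.range N, h (u + a)| ≤ y N := fun u N =>
    le_ciSup (f := fun u => |∑ a ∈ Finset.range N, h (u + a)|)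
      ⟨N, by rintro _ ⟨u, rfl⟩; exact hbound u N⟩ u
  have hyN : ∀ N, y N ≤ N := fun N => ciSup_le fun u => hbound u N
  have hy0 : ∀ N, 0 ≤ y N := fun N => (abs_nonneg _).trans (hle 0 N)
  have hsplit : ∀ u m n : ℕ, ∑ a ∈ Finset.range (m + n), h (u + a) =
      ∑ a ∈ Finset.range m, h (u + a) + ∑ a ∈ Finset.range n, h (u + m + a) := by
    intro u m n
    rw [Finset.sum_range_add]
    simp only [add_assoc]
  have hsub : Subadditive y := by
    intro m n
    refine ciSup_le fun u => ?_
    rw [hsplit]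
    exact (abs_add_le _ _).trans (add_le_add (hle _ _) (hle _ _))
  have hbdd : BddBelow (Set.range fun n => y n / n) :=
    ⟨0, by rintro _ ⟨n, rfl⟩; exact div_nonneg (hy0 n) n.cast_nonneg⟩
  have htend := hsub.tendsto_lim hbdd
  set lam := hsub.lim with hlam
  have hlam0 : 0 ≤ lam :=
    ge_of_tendsto' htend fun n => div_nonneg (hy0 n) n.cast_nonneg
  have hC : ∀ ε > 0, ∃ C : ℝ, 0 ≤ C ∧ ∀ N : ℕ, y N ≤ (lam + ε) * N + C := by
    intro ε hε
    obtain ⟨N₀, hN₀⟩ := Filter.eventually_atTop.1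
      (htend.eventually_lt_const (show lam < lam + ε by linarith))
    refine ⟨N₀, N₀.cast_nonneg, fun N => ?_⟩
    rcases lt_or_ge N N₀ with hN | hN
    · have h1 : (N : ℝ) ≤ N₀ := by exact_mod_cast hN.le
      have h2 : 0 ≤ (lam + ε) * N := by positivity
      linarith [hyN N]
    · rcases Nat.eq_zero_or_pos N with rfl | hpos
      · have := hyN 0
        push_cast at this ⊢
        linarith [(N₀.cast_nonneg : (0 : ℝ) ≤ N₀)]
      · have hp : (0 : ℝ) < N := by exact_mod_cast hpos
        have := (div_lt_iff₀ hp).1 (hN₀ N hN)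
        linarith [(N₀.cast_nonneg : (0 : ℝ) ≤ N₀)]
  have hzero : lam = 0 := by
    refine le_antisymm (le_of_forall_pos_le_add fun η hη => ?_) hlam0
    obtain ⟨C, hC0, hCy⟩ := hC (c * η) (by positivity)
    obtain ⟨L₀, hL₀⟩ := exists_nat_gt (3 * C / (c * η))
    obtain ⟨L, hL₀L, hL, hLu⟩ := hcancel L₀
    have hLR : (0 : ℝ) < L := by exact_mod_cast hL
    have h1 : y L ≤ (lam + c * η) * ((1 - 2 * c) * L) + 3 * C := by
      refine ciSup_le fun u => ?_
      obtain ⟨i, j, r, len, hsum, hlen, hcan⟩ := hLu u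
      have hsumR : (i + j + r : ℝ) ≤ (1 - 2 * c) * L := by
        have : (i + len + j + len + r : ℝ) = L := by exact_mod_cast hsum
        linarith
      rw [← hsum, hsplit, hsplit, hsplit, hsplit]
      rw [Finset.sum_add_distrib] at hcan
      have h2 := (hle u i).trans (hCy i)
      have h3 := (hle (u + (i + len)) j).trans (hCy j)
      have h4 := (hle (u + (i + len + j + len)) r).trans (hCy r)
      calc _ = |∑ a ∈ Finset.range i, h (u + a) + ∑ a ∈ Finset.range j, h (u + (i + len) + a) +
            ∑ a ∈ Finset.range r, h (u + (i + len + j + len) + a)| := by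
            congr 1
            simp only [← add_assoc] at hcan ⊢
            linarith
        _ ≤ |∑ a ∈ Finset.range i, h (u + a)| + |∑ a ∈ Finset.range j, h (u + (i + len) + a)| +
            |∑ a ∈ Finset.range r, h (u + (i + len + j + len) + a)| := abs_add_three _ _ _
        _ ≤ (lam + c * η) * (i + j + r) + 3 * C := by linarith
        _ ≤ _ := by rw [hsum]; gcongr
    have h2 : lam * L ≤ y L := by
      have := hsub.lim_le_div hbdd hL.ne'
      rwa [le_div_iff₀ hLR] at this
    have h3 : 3 * C ≤ c * η * L := by
      rw [div_lt_iff₀ (by positivity)] at hL₀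
      have : (L₀ : ℝ) ≤ L := by exact_mod_cast hL₀L
      nlinarith [mul_pos hc hη]
    have h4 : lam ≤ (lam + c * η) * (1 - 2 * c) + c * η := by
      refine le_of_mul_le_mul_right ?_ hLR
      linarith
    have h5 : c * lam ≤ c * η := by nlinarith [mul_pos hc hη, mul_pos hc (mul_pos hc hη)]
    have := le_of_mul_le_mul_left h5 hc
    linarith
  intro ε hε
  obtain ⟨C, -, hCy⟩ := hC ε hε
  rw [hzero, zero_add] at hCy
  exact ⟨C, fun u N => (hle u N).trans (hCy N)⟩

theorem fib_add_le (M K : ℕ) : Nat.fib (M + K) ≤ 2 ^ K * Nat.fib M ∨ M = 0 := by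
  rcases Nat.eq_zero_or_pos M with h | h
  · exact Or.inr h
  left
  induction K with
  | zero => simp
  | succ K ih =>
    have h1 : Nat.fib (M + (K + 1)) = Nat.fib (M + K - 1) + Nat.fib (M + K) := by
      have := Nat.fib_add_two (n := M + K - 1)
      rwa [show M + K - 1 + 2 = M + (K + 1) by omega, show M + K - 1 + 1 = M + K by omega] at this
    have h2 := Nat.fib_mono (by omega : M + K - 1 ≤ M + K)
    rw [h1, pow_succ]
    nlinarith

/-- Correlations of the Zeckendorf parity along multiples of two different numbers. -/
theorem zeckendorf_correlation_le {p q : ℕ} (hp : 0 < p) (hpq : p < q) :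
    ∀ ε > 0, ∃ C : ℝ, ∀ N : ℕ, |∑ n ∈ Finset.range N, (-1 : ℝ) ^ zeckendorfDigitSum (p * n) *
      (-1) ^ zeckendorfDigitSum (q * n)| ≤ ε * N + C := by
  obtain ⟨K, hK⟩ := exists_parity_flip hp hpq
  set h : ℕ → ℝ := fun n =>
    (-1 : ℝ) ^ zeckendorfDigitSum (p * n) * (-1) ^ zeckendorfDigitSum (q * n) with hh
  have hflip : ∀ m n : ℕ, Odd (zeckendorfDigitSum (p * m) + zeckendorfDigitSum (q * m) +
      (zeckendorfDigitSum (p * n) + zeckendorfDigitSum (q * n))) → h n + h m = 0 := by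
    intro m n hodd
    simp only [hh, ← pow_add]
    rcases Nat.even_or_odd (zeckendorfDigitSum (p * m) + zeckendorfDigitSum (q * m)) with h1 | h1
    · rw [h1.neg_one_pow, (Nat.odd_add'.1 hodd |>.2 h1).neg_one_pow]
      norm_num
    · rw [h1.neg_one_pow, (Nat.odd_add.1 hodd |>.1 h1).neg_one_pow]
      norm_num
  have main := interval_sum_le_of_cancelling (h := h) (fun n => by simp [hh, abs_mul])
    (c := 1 / (2 * 2 ^ K)) (by positivity) ?_
  · intro ε hε
    obtain ⟨C, hC⟩ := main ε hε
    exact ⟨C, fun N => by simpa using hC 0 N⟩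
  intro L₀
  obtain ⟨M, hM⟩ : ∃ M, M = L₀ + 5 := ⟨_, rfl⟩
  have hML : M ≤ Nat.fib (M + K) := (Nat.le_fib_self (by omega)).trans (Nat.fib_mono (by omega))
  refine ⟨2 * Nat.fib (M + K), by omega, by omega, fun u => ?_⟩
  obtain ⟨b, hb, hbu, hub⟩ := exists_high_part (J := M + K) (by omega) (u + Nat.fib (M + K))
  obtain ⟨w, hw1, hw2, hw⟩ := hK M (by omega) b hb
  refine ⟨b - u, w - Nat.fib M, u + 2 * Nat.fib (M + K) - b - w - Nat.fib M, Nat.fib M,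
    by omega, ?_, ?_⟩
  · rcases fib_add_le M K with h1 | h1
    · have h2 : (Nat.fib (M + K) : ℝ) ≤ 2 ^ K * Nat.fib M := by exact_mod_cast h1
      push_cast
      rw [one_div_mul_eq_div, div_le_iff₀ (by positivity)]
      linarith
    · omega
  · refine Finset.sum_eq_zero fun a ha => ?_
    rw [show u + (b - u) + a = a + b by omega,
      show u + (b - u) + Nat.fib M + (w - Nat.fib M) + a = a + w + b by omega]
    exact hflip _ _ (hw a (Finset.mem_range.1 ha))

/-! ### The orthogonality criterion for multiplicative functions -/

theorem abs_sum_dvd_sub_le {d : ℕ} (hd : 0 < d) (N : ℕ) :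
    |∑ n ∈ Finset.range N, (if d ∣ n then (1 : ℝ) else 0) - N / d| ≤ 1 := by
  have hdR : (0 : ℝ) < d := by exact_mod_cast hd
  have hcount : ∑ n ∈ Finset.range N, (if d ∣ n then (1 : ℝ) else 0) = ⌈(N : ℝ) / d⌉₊ := by
    rw [← Finset.sum_filter, Finset.sum_const, nsmul_eq_mul, mul_one]
    congr 1
    have : (Finset.range N).filter (d ∣ ·) = (Finset.range ⌈(N : ℝ) / d⌉₊).image (d * ·) := by
      ext n
      simp only [Finset.mem_filter, Finset.mem_range, Finset.mem_image, Nat.lt_ceil]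
      constructor
      · rintro ⟨hn, k, rfl⟩
        refine ⟨k, ?_, rfl⟩
        rw [lt_div_iff₀' hdR]
        exact_mod_cast hn
      · rintro ⟨k, hk, rfl⟩
        rw [lt_div_iff₀' hdR] at hk
        exact ⟨by exact_mod_cast hk, dvd_mul_right _ _⟩
    rw [this, Finset.card_image_of_injective _ (mul_right_injective₀ hd.ne'), Finset.card_range]
  rw [hcount, abs_le]
  have h1 := Nat.le_ceil ((N : ℝ) / d)
  have h2 := Nat.ceil_lt_add_one (show (0 : ℝ) ≤ (N : ℝ) / d by positivity)
  constructor <;> linarith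

theorem sum_dvd_eq_sum_mul {E : Type*} [AddCommMonoid E] {d : ℕ} (hd : 0 < d) (N : ℕ)
    (g : ℕ → E) :
    ∑ n ∈ Finset.range N, (if d ∣ n then g n else 0) =
      ∑ k ∈ Finset.range N, if d * k < N then g (d * k) else 0 := by
  rw [← Finset.sum_filter, ← Finset.sum_filter]
  refine Finset.sum_nbij' (· / d) (d * ·) ?_ ?_ ?_ ?_ ?_
  · intro n hn
    simp only [Finset.mem_filter, Finset.mem_range] at hn ⊢
    obtain ⟨hn, k, rfl⟩ := hn
    rw [Nat.mul_div_cancel_left _ hd]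
    exact ⟨(Nat.le_mul_of_pos_left k hd).trans_lt hn, hn⟩
  · intro k hk
    simp only [Finset.mem_filter, Finset.mem_range] at hk ⊢
    exact ⟨hk.2, dvd_mul_right _ _⟩
  · intro n hn
    exact Nat.mul_div_cancel' (Finset.mem_filter.1 hn).2
  · intro k _
    exact Nat.mul_div_cancel_left _ hd
  · intro n hn
    rw [Nat.mul_div_cancel' (Finset.mem_filter.1 hn).2]

/-- The Turán–Kubilius inequality for a finite set of primes. -/
theorem turan_kubilius {P : Finset ℕ} (hP : ∀ p ∈ P, p.Prime) (N : ℕ) :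
    ∑ n ∈ Finset.range N,
      ((∑ p ∈ P, if p ∣ n then (1 : ℝ) else 0) - ∑ p ∈ P, 1 / (p : ℝ)) ^ 2 ≤
      N * (∑ p ∈ P, 1 / (p : ℝ)) + ((P.card : ℝ) ^ 2 + 2 * (∑ p ∈ P, 1 / (p : ℝ)) * P.card) := by
  set A := ∑ p ∈ P, 1 / (p : ℝ) with hA
  have hA0 : 0 ≤ A := Finset.sum_nonneg fun p _ => by positivity
  have hsq : ∑ n ∈ Finset.range N, (∑ p ∈ P, if p ∣ n then (1 : ℝ) else 0) ^ 2 ≤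
      N * A ^ 2 + (P.card : ℝ) ^ 2 + N * A := by
    have h1 : ∀ p ∈ P, ∀ q ∈ P, ∑ n ∈ Finset.range N,
        ((if p ∣ n then (1 : ℝ) else 0) * (if q ∣ n then (1 : ℝ) else 0)) ≤
        N * (1 / (p : ℝ) * (1 / q)) + 1 + if p = q then N * (1 / (p : ℝ)) else 0 := by
      intro p hp q hq
      have hp0 := (hP p hp).pos
      have hq0 := (hP q hq).pos
      split_ifs with hpq
      · subst hpq
        have h2 := (abs_le.1 (abs_sum_dvd_sub_le hp0 N)).2
        have h3 : ∑ n ∈ Finset.range N,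
            ((if p ∣ n then (1 : ℝ) else 0) * (if p ∣ n then (1 : ℝ) else 0)) =
            ∑ n ∈ Finset.range N, (if p ∣ n then (1 : ℝ) else 0) :=
          Finset.sum_congr rfl fun n _ => by split_ifs <;> simp
        rw [h3]
        have h4 : 0 ≤ (N : ℝ) * (1 / (p : ℝ) * (1 / p)) := by positivity
        rw [mul_one_div (N : ℝ)]
        linarith
      · have hcop := (Nat.coprime_primes (hP p hp) (hP q hq)).2 hpq
        have h2 := (abs_le.1 (abs_sum_dvd_sub_le (Nat.mul_pos hp0 hq0) N)).2
        have h3 : ∑ n ∈ Finset.range N,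
            ((if p ∣ n then (1 : ℝ) else 0) * (if q ∣ n then (1 : ℝ) else 0)) =
            ∑ n ∈ Finset.range N, (if p * q ∣ n then (1 : ℝ) else 0) := by
          refine Finset.sum_congr rfl fun n _ => ?_
          rw [ite_zero_mul_ite_zero, mul_one]
          exact if_congr ⟨fun h => hcop.mul_dvd_of_dvd_of_dvd h.1 h.2,
            fun h => ⟨(dvd_mul_right p q).trans h, (dvd_mul_left q p).trans h⟩⟩ rfl rfl
        rw [h3]
        have h4 : (N : ℝ) / (p * q : ℕ) = N * (1 / (p : ℝ) * (1 / q)) := by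
          push_cast
          field_simp
        linarith
    calc ∑ n ∈ Finset.range N, (∑ p ∈ P, if p ∣ n then (1 : ℝ) else 0) ^ 2
        = ∑ p ∈ P, ∑ q ∈ P, ∑ n ∈ Finset.range N,
          ((if p ∣ n then (1 : ℝ) else 0) * (if q ∣ n then (1 : ℝ) else 0)) := by
          simp_rw [sq, Finset.sum_mul_sum]
          rw [Finset.sum_comm]
          exact Finset.sum_congr rfl fun p _ => Finset.sum_comm
      _ ≤ ∑ p ∈ P, ∑ q ∈ P,
          (N * (1 / (p : ℝ) * (1 / q)) + 1 + if p = q then N * (1 / (p : ℝ)) else 0) :=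
          Finset.sum_le_sum fun p hp => Finset.sum_le_sum fun q hq => h1 p hp q hq
      _ = N * A ^ 2 + (P.card : ℝ) ^ 2 + N * A := by
          simp only [Finset.sum_add_distrib, Finset.sum_ite_eq, Finset.sum_const, nsmul_eq_mul,
            mul_one]
          rw [Finset.sum_ite_of_true (fun p hp => hp), ← Finset.mul_sum, ← hA, sq A, hA,
            Finset.sum_mul_sum, Finset.mul_sum]
          simp only [Finset.mul_sum, sq]
  have hlin : N * A - P.card ≤
      ∑ n ∈ Finset.range N, (∑ p ∈ P, if p ∣ n then (1 : ℝ) else 0) := by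
    rw [Finset.sum_comm, hA, Finset.mul_sum, Finset.cast_card, ← Finset.sum_sub_distrib]
    refine Finset.sum_le_sum fun p hp => ?_
    have h2 := (abs_le.1 (abs_sum_dvd_sub_le (hP p hp).pos N)).1
    rw [mul_one_div]
    linarith
  calc _ = ∑ n ∈ Finset.range N, (∑ p ∈ P, if p ∣ n then (1 : ℝ) else 0) ^ 2 -
        2 * A * ∑ n ∈ Finset.range N, (∑ p ∈ P, if p ∣ n then (1 : ℝ) else 0) + N * A ^ 2 := by
        rw [Finset.mul_sum, ← Finset.sum_sub_distrib]
        have : (N : ℝ) * A ^ 2 = ∑ n ∈ Finset.range N, A ^ 2 := by simp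
        rw [this, ← Finset.sum_add_distrib]
        exact Finset.sum_congr rfl fun n _ => by ring
    _ ≤ _ := by nlinarith [mul_le_mul_of_nonneg_left hlin hA0]

theorem sum_norm_le_sqrt {E : Type*} [SeminormedAddCommGroup E] {N : ℕ} {v : ℕ → E} {X : ℝ}
    (h : ∑ n ∈ Finset.range N, ‖v n‖ ^ 2 ≤ N * X) :
    ∑ n ∈ Finset.range N, ‖v n‖ ≤ N * √X := by
  have h1 := sq_sum_le_card_mul_sum_sq (s := Finset.range N) (f := fun n => ‖v n‖)
  rw [Finset.card_range] at h1
  have h2 : (∑ n ∈ Finset.range N, ‖v n‖) ^ 2 ≤ (N : ℝ) ^ 2 * X := by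
    refine h1.trans ?_
    rw [sq, mul_assoc]
    gcongr
  rw [← Real.sqrt_sq (N.cast_nonneg : (0 : ℝ) ≤ N), ← Real.sqrt_mul (sq_nonneg _)]
  exact Real.le_sqrt_of_sq_le h2

theorem filter_mul_lt_eq_range {q : ℕ} (hq : 0 < q) (N : ℕ) :
    ∃ K ≤ N, (Finset.range N).filter (fun k => q * k < N) = Finset.range K := by
  refine ⟨(N + q - 1) / q, ?_, ?_⟩
  · rw [Nat.div_le_iff_le_mul_add_pred hq]
    have := Nat.le_mul_of_pos_left N hq
    omega
  · have key : ∀ k, k < (N + q - 1) / q ↔ q * k < N := by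
      intro k
      rw [Nat.lt_iff_add_one_le, Nat.le_div_iff_mul_le hq, add_mul, mul_comm k q]
      omega
    ext k
    simp only [Finset.mem_filter, Finset.mem_range, key]
    refine ⟨fun h => h.2, fun h => ⟨(Nat.le_mul_of_pos_left k hq).trans_lt h, h⟩⟩

theorem exists_correlation_bound {f : ℕ → ℝ}
    (hcorr : ∀ p q : ℕ, p.Prime → q.Prime → p < q → ∀ ε > 0, ∃ C : ℝ, ∀ N : ℕ,
      |∑ n ∈ Finset.range N, f (p * n) * f (q * n)| ≤ ε * N + C)
    {p q : ℕ} (hp : p.Prime) (hq : q.Prime) (hpq : p ≠ q) {ε : ℝ} (hε : 0 < ε) :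
    ∃ C : ℝ, ∀ N : ℕ, |∑ k ∈ Finset.range N, (if p * k < N then f (p * k) else 0) *
      (if q * k < N then f (q * k) else 0)| ≤ ε * N + C := by
  wlog hlt : p < q generalizing p q
  · obtain ⟨C, hC⟩ := this hq hp hpq.symm (by omega)
    refine ⟨C, fun N => ?_⟩
    simp_rw [mul_comm (ite (p * _ < N) _ _)]
    exact hC N
  obtain ⟨C, hC⟩ := hcorr p q hp hq hlt ε hε
  refine ⟨C, fun N => ?_⟩
  obtain ⟨K, hK, hfilter⟩ := filter_mul_lt_eq_range hq.pos N
  have h1 : ∑ k ∈ Finset.range N, (if p * k < N then f (p * k) else 0) *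
      (if q * k < N then f (q * k) else 0) = ∑ k ∈ Finset.range K, f (p * k) * f (q * k) := by
    rw [← hfilter, Finset.sum_filter]
    refine Finset.sum_congr rfl fun k _ => ?_
    by_cases h : q * k < N
    · have : p * k < N := (Nat.mul_le_mul_right k hlt.le).trans_lt h
      simp [h, this]
    · simp [h]
  rw [h1]
  refine (hC K).trans ?_
  gcongr

section Katai

variable {f : ℕ → ℝ} {m : ArithmeticFunction ℂ} {B : ℝ} {P : Finset ℕ}

/-- The bilinear part of the orthogonality criterion. -/
theorem exists_bilinear_bound (hf : ∀ n, |f n| ≤ 1)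
    (hcorr : ∀ p q : ℕ, p.Prime → q.Prime → p < q → ∀ ε > 0, ∃ C : ℝ, ∀ N : ℕ,
      |∑ n ∈ Finset.range N, f (p * n) * f (q * n)| ≤ ε * N + C)
    (hm : ∀ n, ‖m n‖ ≤ B) (hP : ∀ p ∈ P, p.Prime) :
    ∃ C : ℝ, ∀ N : ℕ, ∑ k ∈ Finset.range N,
      ‖∑ p ∈ P, m p * ((if p * k < N then f (p * k) else 0 : ℝ) : ℂ)‖ ^ 2 ≤
      B ^ 2 * (N * (∑ p ∈ P, 1 / (p : ℝ) + 1) + C) := by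
  have hB : 0 ≤ B := (norm_nonneg _).trans (hm 0)
  set ε : ℝ := 1 / ((P.card : ℝ) ^ 2 + 1) with hε
  have hε0 : 0 < ε := by positivity
  have hεP : (P.card : ℝ) ^ 2 * ε ≤ 1 := by
    rw [hε, mul_one_div, div_le_one (by positivity)]
    linarith
  have hC : ∀ p q : ℕ, ∃ C : ℝ, p ∈ P → q ∈ P → ∀ N : ℕ,
      |∑ k ∈ Finset.range N, (if p * k < N then f (p * k) else 0) *
        (if q * k < N then f (q * k) else 0)| ≤
      ε * N + C + if p = q then N * (1 / (p : ℝ)) else 0 := by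
    intro p q
    by_cases hpP : p ∈ P
    swap
    · exact ⟨0, fun h => absurd h hpP⟩
    by_cases hqP : q ∈ P
    swap
    · exact ⟨0, fun _ h => absurd h hqP⟩
    by_cases hpq : p = q
    · subst hpq
      refine ⟨1, fun _ _ N => ?_⟩
      rw [if_pos rfl]
      have h2 := (abs_le.1 (abs_sum_dvd_sub_le (hP p hpP).pos N)).2
      rw [sum_dvd_eq_sum_mul (hP p hpP).pos] at h2
      have h3 : |∑ k ∈ Finset.range N, (if p * k < N then f (p * k) else 0) *
          (if p * k < N then f (p * k) else 0)| ≤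
          ∑ k ∈ Finset.range N, if p * k < N then (1 : ℝ) else 0 := by
        refine (Finset.abs_sum_le_sum_abs _ _).trans (Finset.sum_le_sum fun k _ => ?_)
        split_ifs
        · rw [abs_mul]
          exact mul_le_one₀ (hf _) (abs_nonneg _) (hf _)
        · simp
      rw [mul_one_div]
      have : 0 ≤ ε * N := by positivity
      linarith
    · obtain ⟨C, hC⟩ := exists_correlation_bound hcorr (hP p hpP) (hP q hqP) hpq hε0
      exact ⟨C, fun _ _ N => by simpa [hpq] using hC N⟩
  choose C hC using hC
  refine ⟨∑ p ∈ P, ∑ q ∈ P, C p q, fun N => ?_⟩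
  set g : ℕ → ℕ → ℝ := fun p k => if p * k < N then f (p * k) else 0 with hg
  have hexp : ((∑ k ∈ Finset.range N, ‖∑ p ∈ P, m p * (g p k : ℂ)‖ ^ 2 : ℝ) : ℂ) =
      ∑ p ∈ P, ∑ q ∈ P, m p * (starRingEnd ℂ) (m q) *
        ((∑ k ∈ Finset.range N, g p k * g q k : ℝ) : ℂ) := by
    push_cast
    simp_rw [← Complex.mul_conj', map_sum, Finset.sum_mul_sum]
    rw [Finset.sum_comm]
    refine Finset.sum_congr rfl fun p _ => ?_
    rw [Finset.sum_comm]
    refine Finset.sum_congr rfl fun q _ => ?_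
    rw [Finset.mul_sum]
    refine Finset.sum_congr rfl fun k _ => ?_
    rw [map_mul, Complex.conj_ofReal]
    ring
  have hnn : 0 ≤ ∑ k ∈ Finset.range N, ‖∑ p ∈ P, m p * (g p k : ℂ)‖ ^ 2 := by positivity
  calc ∑ k ∈ Finset.range N, ‖∑ p ∈ P, m p * (g p k : ℂ)‖ ^ 2
      = ‖((∑ k ∈ Finset.range N, ‖∑ p ∈ P, m p * (g p k : ℂ)‖ ^ 2 : ℝ) : ℂ)‖ := by
        rw [Complex.norm_real, Real.norm_of_nonneg hnn]
    _ ≤ ∑ p ∈ P, ∑ q ∈ P, B ^ 2 * (ε * N + C p q + if p = q then N * (1 / (p : ℝ)) else 0) := by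
        rw [hexp]
        refine (norm_sum_le _ _).trans (Finset.sum_le_sum fun p hp => ?_)
        refine (norm_sum_le _ _).trans (Finset.sum_le_sum fun q hq => ?_)
        rw [norm_mul, norm_mul, RCLike.norm_conj, Complex.norm_real, Real.norm_eq_abs, sq]
        gcongr
        · exact hm p
        · exact hm q
        · exact hC p q hp hq N
    _ = B ^ 2 * ((P.card : ℝ) ^ 2 * ε * N + ∑ p ∈ P, ∑ q ∈ P, C p q +
          N * ∑ p ∈ P, 1 / (p : ℝ)) := by
        simp only [← Finset.mul_sum, Finset.sum_add_distrib, Finset.sum_ite_eq, Finset.sum_const,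
          nsmul_eq_mul]
        rw [Finset.sum_ite_of_true (fun p hp => hp), ← Finset.mul_sum]
        ring
    _ ≤ _ := by
        refine mul_le_mul_of_nonneg_left ?_ (sq_nonneg B)
        have : (P.card : ℝ) ^ 2 * ε * N ≤ 1 * N := by gcongr
        linarith

/-- Replacing `m (p k)` by `m p * m k` is harmless on average. -/
theorem norm_sum_multiplicative_defect_le (hf : ∀ n, |f n| ≤ 1) (hmult : m.IsMultiplicative)
    (hB1 : 1 ≤ B) (hm : ∀ n, ‖m n‖ ≤ B) {p : ℕ} (hp : p.Prime) (N : ℕ) :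
    ‖∑ k ∈ Finset.range N,
      (((if p * k < N then f (p * k) else 0 : ℝ) : ℂ)) * (m (p * k) - m p * m k)‖ ≤
      2 * B ^ 2 * (N * (1 / (p : ℝ) ^ 2) + 1) := by
  have hcount : ∑ k ∈ Finset.range N,
      (if p * k < N then (if p ^ 2 ∣ p * k then (1 : ℝ) else 0) else 0) ≤
      N * (1 / (p : ℝ) ^ 2) + 1 := by
    rw [← sum_dvd_eq_sum_mul hp.pos N (fun n => if p ^ 2 ∣ n then (1 : ℝ) else 0)]
    have h1 := (abs_le.1 (abs_sum_dvd_sub_le (pow_pos hp.pos 2) N)).2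
    have h2 : ∑ n ∈ Finset.range N, (if p ∣ n then (if p ^ 2 ∣ n then (1 : ℝ) else 0) else 0) ≤
        ∑ n ∈ Finset.range N, (if p ^ 2 ∣ n then (1 : ℝ) else 0) := by
      refine Finset.sum_le_sum fun n _ => ?_
      split_ifs <;> norm_num
    rw [mul_one_div]
    push_cast at h1
    linarith
  refine (norm_sum_le _ _).trans ?_
  refine le_trans ?_ (mul_le_mul_of_nonneg_left hcount (by positivity))
  rw [Finset.mul_sum]
  refine Finset.sum_le_sum fun k _ => ?_
  by_cases h : p * k < N
  · rw [if_pos h, if_pos h]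
    by_cases hpk : p ∣ k
    · rw [if_pos (by rw [sq]; exact Nat.mul_dvd_mul_left p hpk), mul_one, norm_mul,
        Complex.norm_real, Real.norm_eq_abs]
      have h1 : ‖m (p * k) - m p * m k‖ ≤ 2 * B ^ 2 := by
        refine (norm_sub_le _ _).trans ?_
        rw [norm_mul]
        have h2 : ‖m p‖ * ‖m k‖ ≤ B * B := by gcongr <;> exact hm _
        nlinarith [hm (p * k)]
      calc |f (p * k)| * ‖m (p * k) - m p * m k‖ ≤ 1 * (2 * B ^ 2) := by
            gcongr
            exact hf _
        _ = _ := one_mul _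
    · rw [hmult.map_mul_of_coprime ((Nat.Prime.coprime_iff_not_dvd hp).2 hpk), sub_self, mul_zero,
        norm_zero]
      positivity
  · rw [if_neg h, if_neg h]
    simp

theorem exists_katai_bound (hf : ∀ n, |f n| ≤ 1)
    (hcorr : ∀ p q : ℕ, p.Prime → q.Prime → p < q → ∀ ε > 0, ∃ C : ℝ, ∀ N : ℕ,
      |∑ n ∈ Finset.range N, f (p * n) * f (q * n)| ≤ ε * N + C)
    (hmult : m.IsMultiplicative) (hB1 : 1 ≤ B) (hm : ∀ n, ‖m n‖ ≤ B) (hP : ∀ p ∈ P, p.Prime) :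
    ∀ᶠ N : ℕ in Filter.atTop,
      (∑ p ∈ P, 1 / (p : ℝ)) * ‖∑ n ∈ Finset.range N, (f n : ℂ) * m n‖ ≤
      N * (B ^ 2 * (2 * √(∑ p ∈ P, 1 / (p : ℝ) + 2) + 2 * (∑' n : ℕ, 1 / (n : ℝ) ^ 2) + 2)) := by
  obtain ⟨C, hC⟩ := exists_bilinear_bound hf hcorr hm hP
  set A := ∑ p ∈ P, 1 / (p : ℝ) with hA
  have hA0 : 0 ≤ A := Finset.sum_nonneg fun p _ => by positivity
  set Z := ∑' n : ℕ, 1 / (n : ℝ) ^ 2 with hZ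
  have hZP : ∑ p ∈ P, 1 / (p : ℝ) ^ 2 ≤ Z :=
    (Real.summable_one_div_nat_pow.2 one_lt_two).sum_le_tsum P fun n _ => by positivity
  have hB0 : 0 ≤ B := zero_le_one.trans hB1
  filter_upwards [Filter.eventually_ge_atTop ⌈C⌉₊, Filter.eventually_ge_atTop P.card,
    Filter.eventually_ge_atTop ⌈(P.card : ℝ) ^ 2 + 2 * A * P.card⌉₊] with N hN1 hN2 hN3
  replace hN1 : C ≤ N := Nat.ceil_le.1 hN1
  replace hN2 : (P.card : ℝ) ≤ N := by exact_mod_cast hN2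
  replace hN3 : (P.card : ℝ) ^ 2 + 2 * A * P.card ≤ N := Nat.ceil_le.1 hN3
  set w : ℕ → ℝ := fun n => ∑ p ∈ P, if p ∣ n then (1 : ℝ) else 0 with hw
  set g : ℕ → ℕ → ℝ := fun p k => if p * k < N then f (p * k) else 0 with hg
  -- the variance term
  have hvar : ‖∑ n ∈ Finset.range N, (f n : ℂ) * m n * ((w n - A : ℝ) : ℂ)‖ ≤
      B * (N * √(A + 2)) := by
    have h1 : ∑ n ∈ Finset.range N, ‖w n - A‖ ^ 2 ≤ N * (A + 2) := by
      simp only [Real.norm_eq_abs, sq_abs]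
      refine (turan_kubilius hP N).trans ?_
      rw [← hA]
      linarith [(N.cast_nonneg : (0 : ℝ) ≤ N)]
    refine le_trans ?_ (mul_le_mul_of_nonneg_left (sum_norm_le_sqrt h1) hB0)
    rw [Finset.mul_sum]
    refine (norm_sum_le _ _).trans (Finset.sum_le_sum fun n _ => ?_)
    rw [norm_mul, norm_mul, Complex.norm_real, Complex.norm_real]
    gcongr
    calc ‖f n‖ * ‖m n‖ ≤ 1 * B := by
          gcongr
          · exact hf n
          · exact hm n
      _ = B := one_mul B
  -- the bilinear term
  have hbil : ‖∑ k ∈ Finset.range N, m k * ∑ p ∈ P, m p * (g p k : ℂ)‖ ≤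
      B ^ 2 * (N * √(A + 2)) := by
    have h1 : ∑ k ∈ Finset.range N, ‖∑ p ∈ P, m p * (g p k : ℂ)‖ ^ 2 ≤ N * (B ^ 2 * (A + 2)) := by
      refine (hC N).trans ?_
      calc B ^ 2 * (N * (A + 1) + C) ≤ B ^ 2 * (N * (A + 1) + N) := by gcongr
        _ = _ := by ring
    have h2 := sum_norm_le_sqrt h1
    rw [Real.sqrt_mul (sq_nonneg B), Real.sqrt_sq hB0] at h2
    calc _ ≤ ∑ k ∈ Finset.range N, B * ‖∑ p ∈ P, m p * (g p k : ℂ)‖ := by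
          refine (norm_sum_le _ _).trans (Finset.sum_le_sum fun k _ => ?_)
          rw [norm_mul]
          gcongr
          exact hm k
      _ ≤ B * (N * (B * √(A + 2))) := by
          rw [← Finset.mul_sum]
          gcongr
      _ = _ := by ring
  have hdef : ‖∑ p ∈ P, ∑ k ∈ Finset.range N, (g p k : ℂ) * (m (p * k) - m p * m k)‖ ≤
      2 * B ^ 2 * (N * Z + N) := by
    calc _ ≤ ∑ p ∈ P, 2 * B ^ 2 * (N * (1 / (p : ℝ) ^ 2) + 1) :=
          (norm_sum_le _ _).trans (Finset.sum_le_sum fun p hp =>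
            norm_sum_multiplicative_defect_le hf hmult hB1 hm (hP p hp) N)
      _ = 2 * B ^ 2 * (N * ∑ p ∈ P, 1 / (p : ℝ) ^ 2 + P.card) := by
          rw [← Finset.mul_sum, Finset.sum_add_distrib, ← Finset.mul_sum]
          simp
      _ ≤ _ := by gcongr
  have hsplit : ∑ n ∈ Finset.range N, (f n : ℂ) * m n * (w n : ℂ) =
      ∑ k ∈ Finset.range N, m k * (∑ p ∈ P, m p * (g p k : ℂ)) +
        ∑ p ∈ P, ∑ k ∈ Finset.range N, (g p k : ℂ) * (m (p * k) - m p * m k) := by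
    have h1 : ∑ n ∈ Finset.range N, (f n : ℂ) * m n * (w n : ℂ) =
        ∑ p ∈ P, ∑ k ∈ Finset.range N, (g p k : ℂ) * m (p * k) := by
      have h2 : ∀ p ∈ P, ∑ k ∈ Finset.range N, (g p k : ℂ) * m (p * k) =
          ∑ n ∈ Finset.range N, if p ∣ n then (f n : ℂ) * m n else 0 := by
        intro p hp
        rw [sum_dvd_eq_sum_mul (hP p hp).pos]
        refine Finset.sum_congr rfl fun k _ => ?_
        simp only [hg]
        split_ifs <;> simp
      rw [Finset.sum_congr rfl h2, Finset.sum_comm]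
      refine Finset.sum_congr rfl fun n _ => ?_
      simp only [hw]
      push_cast
      rw [Finset.mul_sum]
      refine Finset.sum_congr rfl fun p _ => ?_
      split_ifs <;> simp
    have h3 : ∑ k ∈ Finset.range N, m k * (∑ p ∈ P, m p * (g p k : ℂ)) =
        ∑ p ∈ P, ∑ k ∈ Finset.range N, (g p k : ℂ) * (m p * m k) := by
      rw [Finset.sum_comm]
      refine Finset.sum_congr rfl fun k _ => ?_
      rw [Finset.mul_sum]
      exact Finset.sum_congr rfl fun p _ => by ring
    rw [h1, h3, ← Finset.sum_add_distrib]
    refine Finset.sum_congr rfl fun p _ => ?_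
    rw [← Finset.sum_add_distrib]
    exact Finset.sum_congr rfl fun k _ => by ring
  have hAS : (A : ℂ) * ∑ n ∈ Finset.range N, (f n : ℂ) * m n =
      ∑ n ∈ Finset.range N, (f n : ℂ) * m n * (w n : ℂ) -
        ∑ n ∈ Finset.range N, (f n : ℂ) * m n * ((w n - A : ℝ) : ℂ) := by
    rw [← Finset.sum_sub_distrib, Finset.mul_sum]
    exact Finset.sum_congr rfl fun n _ => by push_cast; ring
  have hnorm : A * ‖∑ n ∈ Finset.range N, (f n : ℂ) * m n‖ =
      ‖(A : ℂ) * ∑ n ∈ Finset.range N, (f n : ℂ) * m n‖ := by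
    rw [norm_mul, Complex.norm_real, Real.norm_of_nonneg hA0]
  rw [hnorm, hAS, hsplit]
  refine (norm_sub_le _ _).trans ?_
  have h1 := norm_add_le (∑ k ∈ Finset.range N, m k * (∑ p ∈ P, m p * (g p k : ℂ)))
    (∑ p ∈ P, ∑ k ∈ Finset.range N, (g p k : ℂ) * (m (p * k) - m p * m k))
  have h2 : B * (N * √(A + 2)) ≤ B ^ 2 * (N * √(A + 2)) := by
    gcongr
    nlinarith
  linarith

theorem exists_primes_sum_one_div_ge (R : ℝ) :
    ∃ P : Finset ℕ, (∀ p ∈ P, p.Prime) ∧ R ≤ ∑ p ∈ P, 1 / (p : ℝ) := by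
  have h := (not_summable_iff_tendsto_nat_atTop_of_nonneg (fun n =>
    Set.indicator_nonneg (fun i _ => by positivity) n)).1 not_summable_one_div_on_primes
  obtain ⟨n, hn⟩ := (h.eventually_ge_atTop R).exists
  refine ⟨(Finset.range n).filter Nat.Prime, fun p hp => (Finset.mem_filter.1 hp).2, ?_⟩
  rw [Finset.sum_filter]
  refine hn.trans_eq (Finset.sum_congr rfl fun i _ => ?_)
  rw [Set.indicator_apply]
  rfl

/-- The Daboussi–Kátai criterion. -/
theorem isLittleO_sum_mul_of_correlation (hf : ∀ n, |f n| ≤ 1)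
    (hcorr : ∀ p q : ℕ, p.Prime → q.Prime → p < q → ∀ ε > 0, ∃ C : ℝ, ∀ N : ℕ,
      |∑ n ∈ Finset.range N, f (p * n) * f (q * n)| ≤ ε * N + C)
    (hmult : m.IsMultiplicative) (hm : ∃ C : ℝ, ∀ n, ‖m n‖ ≤ C) :
    (fun N : ℕ => ∑ n ∈ Finset.range N, (f n : ℂ) * m n) =o[Filter.atTop]
      (fun N : ℕ => (N : ℝ)) := by
  obtain ⟨C, hC⟩ := hm
  set B := max C 1 with hB
  have hB1 : 1 ≤ B := le_max_right _ _
  have hmB : ∀ n, ‖m n‖ ≤ B := fun n => (hC n).trans (le_max_left _ _)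
  rw [Asymptotics.isLittleO_iff]
  intro η hη
  set Z := ∑' n : ℕ, 1 / (n : ℝ) ^ 2 with hZ
  have hZ0 : 0 ≤ Z := tsum_nonneg fun n => by positivity
  set D := B ^ 2 * (2 * Z + 6) / η with hD
  have hD0 : 0 ≤ D := by positivity
  obtain ⟨P, hP, hPA⟩ := exists_primes_sum_one_div_ge (max 1 (D ^ 2))
  set A := ∑ p ∈ P, 1 / (p : ℝ) with hA
  have hA1 : 1 ≤ A := (le_max_left _ _).trans hPA
  have hDA : D ≤ √A := Real.le_sqrt_of_sq_le ((le_max_right _ _).trans hPA)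
  filter_upwards [exists_katai_bound hf hcorr hmult hB1 hmB hP] with N hN
  rw [← hA, ← hZ] at hN
  have hA0 : 0 < A := by linarith
  have hs1 : 1 ≤ √A := Real.one_le_sqrt.2 hA1
  have hs2 : √(A + 2) ≤ 2 * √A := by
    rw [Real.sqrt_le_left (by positivity), mul_pow, Real.sq_sqrt hA0.le]
    linarith
  have h1 : B ^ 2 * (2 * √(A + 2) + 2 * Z + 2) ≤ η * A := by
    calc B ^ 2 * (2 * √(A + 2) + 2 * Z + 2) ≤ B ^ 2 * ((2 * Z + 6) * √A) := by
          gcongr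
          nlinarith
      _ = η * (D * √A) := by rw [hD]; field_simp
      _ ≤ η * (√A * √A) := by gcongr
      _ = η * A := by rw [Real.mul_self_sqrt hA0.le]
  rw [Real.norm_natCast]
  refine le_of_mul_le_mul_left ?_ hA0
  calc _ ≤ _ := hN
    _ ≤ N * (η * A) := by gcongr
    _ = _ := by ring

end Katai

/-! ### The Zeckendorf parity sequence is morphic -/

/-- The signed Fibonacci substitution; a letter is the last digit together with the parity of
the digit sum. -/
def zeckSubst : Bool × Bool → List (Bool × Bool)
  | (false, s) => [(false, s), (true, !s)]
  | (true, s) => [(false, s)]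

/-- Reversing the parity component of a letter. -/
def flipParity (x : Bool × Bool) : Bool × Bool := (x.1, !x.2)

theorem flatMap_zeckSubst_map_flipParity (l : List (Bool × Bool)) :
    (l.map flipParity).flatMap zeckSubst = (l.flatMap zeckSubst).map flipParity := by
  rw [List.flatMap_map, List.map_flatMap]
  congr 1
  funext x
  rcases x with ⟨_ | _, _ | _⟩ <;> rfl

theorem substIterate_zeckSubst_add_two (k : ℕ) :
    substIterate zeckSubst (false, false) (k + 2) =
      substIterate zeckSubst (false, false) (k + 1) ++
        (substIterate zeckSubst (false, false) k).map flipParity := by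
  induction k with
  | zero => rfl
  | succ k ih =>
    conv_lhs => rw [substIterate, ih, List.flatMap_append, flatMap_zeckSubst_map_flipParity]
    rfl

theorem length_substIterate_zeckSubst (k : ℕ) :
    (substIterate zeckSubst (false, false) k).length = Nat.fib (k + 2) := by
  induction k using Nat.twoStepInduction with
  | zero => rfl
  | one => rfl
  | more k ih1 ih2 =>
    rw [substIterate_zeckSubst_add_two, List.length_append, List.length_map, ih1, ih2,
      Nat.fib_add_two (n := k + 2), add_comm]

theorem getElem_substIterate_zeckSubst (k i : ℕ)
    (h : i < (substIterate zeckSubst (false, false) k).length) :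
    (if ((substIterate zeckSubst (false, false) k)[i]).2 then (-1 : ℤ) else 1) =
      (-1) ^ zeckendorfDigitSum i := by
  induction k using Nat.twoStepInduction generalizing i with
  | zero =>
    have : i = 0 := by simpa [substIterate] using h
    subst this
    simp [substIterate, zeckendorfDigitSum_zero]
  | one =>
    have hi : i < 2 := h
    interval_cases i
    · simp [substIterate, zeckSubst, zeckendorfDigitSum_zero]
    · have : zeckendorfDigitSum 1 = 1 := zeckendorfDigitSum_fib (i := 2) le_rfl
      simp [substIterate, zeckSubst, this]
  | more k ih1 ih2 =>
    have hlen : i < Nat.fib (k + 2) + Nat.fib (k + 3) := by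
      rwa [length_substIterate_zeckSubst, Nat.fib_add_two] at h
    simp only [substIterate_zeckSubst_add_two, List.getElem_append, List.getElem_map]
    split_ifs with h1 h2 h2
    · rw [← ih2 i h1, if_pos h2]
    · rw [← ih2 i h1, if_neg h2]
    all_goals
      rw [length_substIterate_zeckSubst, show k + 1 + 2 = k + 3 from rfl] at h1
      have h3 := ih1 (i - Nat.fib (k + 3)) (by rw [length_substIterate_zeckSubst]; omega)
      have h4 : zeckendorfDigitSum i = zeckendorfDigitSum (i - Nat.fib (k + 3)) + 1 := by
        rw [← zeckendorfDigitSum_add_fib (J := k + 2) (by omega) (by omega)]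
        congr 1
        exact (Nat.sub_add_cancel (not_lt.1 h1)).symm
      simp only [length_substIterate_zeckSubst, flipParity] at h2
      rw [h4, pow_succ, ← h3]
      simp_all

theorem isMorphic_zeckendorf : IsMorphic (fun n : ℕ => (-1 : ℤ) ^ zeckendorfDigitSum n) := by
  refine ⟨Bool × Bool, inferInstance, zeckSubst, (false, false), fun x => if x.2 then -1 else 1,
    ⟨_, rfl⟩, fun L => ⟨L + 3, ?_⟩, getElem_substIterate_zeckSubst⟩
  rw [length_substIterate_zeckSubst]
  exact (by omega : L ≤ L + 3 + 2).trans (Nat.le_fib_self (by omega))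

/-! ### Orthogonality to bounded multiplicative functions -/

theorem isLittleO_zeckendorf_mul {m : ArithmeticFunction ℂ} (hmult : m.IsMultiplicative)
    (hm : ∃ C : ℝ, ∀ n, ‖m n‖ ≤ C) :
    (fun N : ℕ => ∑ n ∈ Finset.range N, (-1 : ℂ) ^ zeckendorfDigitSum n * m n)
      =o[Filter.atTop] (fun N : ℕ => (N : ℝ)) := by
  have := isLittleO_sum_mul_of_correlation (f := fun n => (-1 : ℝ) ^ zeckendorfDigitSum n)
    (fun n => by simp) (fun p q hp _ hpq => zeckendorf_correlation_le hp.pos hpq) hmult hm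
  simpa using this

theorem isLittleO_zeckendorf_mul_moebius :
    (fun N : ℕ => ∑ n ∈ Finset.range N,
        (-1 : ℝ) ^ zeckendorfDigitSum n * ((ArithmeticFunction.moebius n : ℤ) : ℝ))
      =o[Filter.atTop] (fun N : ℕ => (N : ℝ)) := by
  have hbound : ∀ n : ℕ, ‖((ArithmeticFunction.moebius : ArithmeticFunction ℤ) :
      ArithmeticFunction ℂ) n‖ ≤ 1 := by
    intro n
    rw [ArithmeticFunction.intCoe_apply, Complex.norm_intCast]
    exact_mod_cast ArithmeticFunction.abs_moebius_le_one
  have h := isLittleO_zeckendorf_mul ArithmeticFunction.isMultiplicative_moebius.intCast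
    ⟨1, hbound⟩
  refine Asymptotics.IsLittleO.congr_left (f₁ := fun N : ℕ => Complex.re _)
    ((Asymptotics.IsBigO.of_norm_le fun N => Complex.abs_re_le_norm _).trans_isLittleO
      h.norm_left) ?_
  intro N
  rw [Complex.re_sum]
  refine Finset.sum_congr rfl fun n _ => ?_
  have hreal : (-1 : ℂ) ^ zeckendorfDigitSum n * ((ArithmeticFunction.moebius n : ℤ) : ℂ) =
      (((-1 : ℝ) ^ zeckendorfDigitSum n * ((ArithmeticFunction.moebius n : ℤ) : ℝ) : ℝ) : ℂ) := by
    push_cast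
    rfl
  rw [ArithmeticFunction.intCoe_apply, hreal, Complex.ofReal_re]

theorem theorem1 :
    (∀ m : ArithmeticFunction ℂ, m.IsMultiplicative → (∃ C : ℝ, ∀ n : ℕ, ‖m n‖ ≤ C) →
      (fun N : ℕ => ∑ n ∈ Finset.range N, (-1 : ℂ) ^ zeckendorfDigitSum n * m n)
        =o[Filter.atTop] (fun N : ℕ => (N : ℝ))) ∧
    IsMorphic (fun n : ℕ => (-1 : ℤ) ^ zeckendorfDigitSum n) ∧
    (fun N : ℕ => ∑ n ∈ Finset.range N,
        (-1 : ℝ) ^ zeckendorfDigitSum n * ((ArithmeticFunction.moebius n : ℤ) : ℝ))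
      =o[Filter.atTop] (fun N : ℕ => (N : ℝ)) :=
  ⟨fun _ hmult hm => isLittleO_zeckendorf_mul hmult hm, isMorphic_zeckendorf,
    isLittleO_zeckendorf_mul_moebius⟩
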